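/- All graphs are finite and simple. A longest path of a graph $G$ is a path in $G$ with the maximum number of edges among all paths in $G$, and a vertex of $G$ is a Gallai vertex if it lies on every longest path of $G$. A graph $G$ is $k$-connected if $|V(G)|\ge k$ and $G-S$ is connected for every $S\subseteq V(G)$ with $|S|<k$; the connectivity $\kappa(G)$ is the largest $k$ such that $G$ is $k$-connected. Let $\alpha(G)$ be the independence number of $G$. Let $k\ge 1$ be an integer and put $n_0=k(k+2)(2k+3)+1$. (1) If $G$ is a $k$-connected graph with at least $n_0$ vertices and $\alpha(G)\le k+2$, then every vertex of maximum degree in $G$ is a Gallai vertex. (2) The bound $k+2$ in (1) cannot be raised, however large the number of vertices is required to be: for every $N$ there is a $k$-connected graph $G$ with at least $N$ vertices, $\kappa(G)=k$ and $\alpha(G)=k+3$, such that no vertex of maximum degree in $G$ is a Gallai vertex. -/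

import Mathlib

namespace SimpleGraph

/-- A longest path of `G`: a path such that no path of `G` (with any endpoints) has
more edges. -/
def Walk.IsLongestPath {V : Type*} {G : SimpleGraph V} {u v : V} (p : G.Walk u v) : Prop :=
  p.IsPath ∧ ∀ (a b : V) (q : G.Walk a b), q.IsPath → q.length ≤ p.length

/-- A Gallai set (longest path transversal): a set of vertices that meets every longest path. -/
def IsGallaiSet {V : Type*} (G : SimpleGraph V) (S : Set V) : Prop :=
  ∀ (u v : V) (p : G.Walk u v), p.IsLongestPath → ∃ w ∈ S, w ∈ p.support

/-- A Gallai vertex: a vertex that lies on every longest path. -/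
def IsGallaiVertex {V : Type*} (G : SimpleGraph V) (v : V) : Prop :=
  G.IsGallaiSet {v}

/-- A finite graph is `k`-connected if it has at least `k` vertices and deleting any set of
fewer than `k` vertices leaves a connected graph. -/
def IsKConnected {V : Type*} [Fintype V] (G : SimpleGraph V) (k : ℕ) : Prop :=
  k ≤ Fintype.card V ∧
    ∀ S : Finset V, S.card < k → (G.induce {v : V | v ∉ S}).Connected

/-- The connectivity of a finite graph: the largest `k` such that it is `k`-connected. -/
noncomputable def vertexConnectivity {V : Type*} [Fintype V] (G : SimpleGraph V) : ℕ :=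
  sSup {k : ℕ | G.IsKConnected k}

/-- The supremum in the definition of the connectivity is a maximum. -/
theorem isGreatest_vertexConnectivity {V : Type*} [Fintype V] (G : SimpleGraph V) :
    IsGreatest {k : ℕ | G.IsKConnected k} G.vertexConnectivity := by
  have hb : BddAbove {k : ℕ | G.IsKConnected k} := ⟨Fintype.card V, fun _ hk => hk.1⟩
  have hne : {k : ℕ | G.IsKConnected k}.Nonempty :=
    ⟨0, Nat.zero_le _, fun _ hS => absurd hS (Nat.not_lt_zero _)⟩
  exact ⟨Nat.sSup_mem hne hb, fun _ hk => le_csSup hb hk⟩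

end SimpleGraph

/-! (1) Suppose a longest path misses a vertex `v` of maximum degree. Adding a universal vertex `o`
(`cone`) turns the path into a longest cycle `C` through `o`, raises the connectivity bound to `K =
k + 1`, and keeps independent sets at size at most `K + 1`. Let `H` be the component of `v` off `C`.
The neighbours of `H` on `C` cut it into segments. The first vertices of the segments, together with
any independent subset of `H`, are independent; as there are at least `K` cuts by connectivity,
there are exactly `K`, and `H` is a clique.

So the maximum degree of `G`, attained at `v`, is at most `|H| + k - 1`. Closed neighbourhoods of a
maximum independent set cover `G`, hence `|H|` is large and `C` has at most `K(K - 1)` vertices more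
than `K(|H| + 1)`. Any two cuts are joined by a detour through all of `H`, so each segment has at
least `|H|` vertices, and an edge between two segments is neither near both starts nor near both
ends (`Linked.le_of_adj`). Independent sets of segment representatives then show that `C` and `H`
cover everything (`IsSaturated.mem_or_mem`) and that segments are cliques
(`IsSaturated.adj_of_mem_segment`).

Traversing these cliques freely, an edge between two segments can only run from the end of one to
the start of the other. Reroutings that exploit `o`, with one degree count when `K = 2`, exclude
such chords (`IsSaturated.not_adj`). There remain `K + 1` mutually nonadjacent cliques, each with at
least `|H|` vertices, and `K` cuts. A cut other than `o` is either complete to one of the cliques,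
and its degree is too large, or together with a nonneighbour in each it gives `K + 2` independent
vertices (`IsSaturated.false`).

(2) In `joinedCliques` a path crosses between large cliques only through the `k` central vertices,
so it meets at most `k + 1` of the `k + 2` large cliques. Each of them is missed by some longest
path, and all vertices of maximum degree lie in them. -/

namespace SimpleGraph

/-! ### Walks and cycles as vertex lists; the basic exchange on a longest cycle -/

section CyclicLists

variable {W : Type*} {G : SimpleGraph W}

/-- The list `l` is a walk of `G` from `u` to `v`, given by its vertices. -/
def Traces (G : SimpleGraph W) (u : W) (l : List W) (v : W) : Prop :=
  l.IsChain G.Adj ∧ l.head? = some u ∧ l.getLast? = some v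

/-- The list `l` is a closed walk of `G`, given by its vertices without repeating the first. -/
def IsCyclicList (G : SimpleGraph W) (l : List W) : Prop :=
  ∃ u v, G.Traces u l v ∧ G.Adj v u

theorem Traces.ne_nil {u v : W} {l : List W} (h : G.Traces u l v) : l ≠ [] := by
  rintro rfl
  simpa using h.2.1

theorem Traces.head_eq {u v a : W} {l : List W} (h : G.Traces u (a :: l) v) : u = a := by
  simpa using h.2.1.symm

theorem Traces.last_eq {u v a : W} {l : List W} (h : G.Traces u (l ++ [a]) v) : v = a := by
  simpa using h.2.2.symm

theorem Traces.head_mem {u v : W} {l : List W} (h : G.Traces u l v) : u ∈ l :=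
  List.mem_of_mem_head? h.2.1

theorem Traces.last_mem {u v : W} {l : List W} (h : G.Traces u l v) : v ∈ l :=
  List.mem_of_mem_getLast? h.2.2

theorem Traces.single (u : W) : G.Traces u [u] u := by
  simp [Traces]

theorem Traces.append {u v w z : W} {l m : List W} (h₁ : G.Traces u l v) (e : G.Adj v w)
    (h₂ : G.Traces w m z) : G.Traces u (l ++ m) z := by
  refine ⟨h₁.1.append h₂.1 ?_, ?_, ?_⟩
  · intro x hx y hy
    rw [h₁.2.2] at hx
    rw [h₂.2.1] at hy
    simp only [Option.mem_def, Option.some.injEq] at hx hy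
    exact hx ▸ hy ▸ e
  · simp [List.head?_append, h₁.2.1]
  · simp [List.getLast?_append, h₂.2.2]

theorem Traces.reverse {u v : W} {l : List W} (h : G.Traces u l v) :
    G.Traces v l.reverse u := by
  refine ⟨?_, by simp [h.2.2], by simp [h.2.1]⟩
  rw [List.isChain_reverse]
  exact h.1.imp fun _ _ e => e.symm

theorem Traces.split {u v : W} {l m : List W} (h : G.Traces u (l ++ m) v) (hl : l ≠ [])
    (hm : m ≠ []) : ∃ p q, G.Traces u l p ∧ G.Adj p q ∧ G.Traces q m v := by
  obtain ⟨hc, hh, ht⟩ := h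
  rw [List.isChain_append] at hc
  refine ⟨l.getLast hl, m.head hm, ⟨hc.1, ?_, List.getLast?_eq_some_getLast hl⟩,
    hc.2.2 _ (List.getLast?_eq_some_getLast hl) _ (List.head?_eq_some_head hm),
    hc.2.1, List.head?_eq_some_head hm, ?_⟩
  · rwa [List.head?_append_of_ne_nil _ hl] at hh
  · rwa [List.getLast?_append_of_ne_nil _ hm] at ht

theorem Traces.exists_tail {u v : W} {l : List W} (h : G.Traces u l v) : ∃ l', l = u :: l' := by
  cases l with
  | nil => exact absurd rfl h.ne_nil
  | cons a l => exact ⟨l, by rw [h.head_eq]⟩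

theorem IsCyclicList.split {l m : List W} (h : G.IsCyclicList (l ++ m)) (hl : l ≠ [])
    (hm : m ≠ []) : ∃ u p q v, G.Traces u l p ∧ G.Adj p q ∧ G.Traces q m v ∧ G.Adj v u := by
  obtain ⟨u, v, h, e⟩ := h
  obtain ⟨p, q, h₁, e', h₂⟩ := h.split hl hm
  exact ⟨u, p, q, v, h₁, e', h₂, e⟩

theorem IsCyclicList.rotate {l m : List W} (h : G.IsCyclicList (l ++ m)) :
    G.IsCyclicList (m ++ l) := by
  by_cases hl : l = []
  · simpa [hl] using h
  by_cases hm : m = []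
  · simpa [hm] using h
  obtain ⟨u, p, q, v, h₁, e, h₂, e'⟩ := h.split hl hm
  exact ⟨q, p, h₂.append e' h₁, e⟩

theorem IsCyclicList.reverse {l : List W} (h : G.IsCyclicList l) : G.IsCyclicList l.reverse := by
  obtain ⟨u, v, h, e⟩ := h
  exact ⟨v, u, h.reverse, e.symm⟩

/-- The source of all freedom in rerouting: it serves for `H`, for the segments and for the cliques
of the example. -/
theorem exists_traces_of_pairwise [DecidableEq W] {l : List W} (hl : l.Nodup)
    (h : ∀ u ∈ l, ∀ v ∈ l, u ≠ v → G.Adj u v) {p q : W} (hp : p ∈ l) (hq : q ∈ l) (hpq : p ≠ q) :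
    ∃ l', G.Traces p l' q ∧ l'.Perm l := by
  have hperm : (p :: ((l.erase p).erase q ++ [q])).Perm l := by
    have h1 : (q :: (l.erase p).erase q).Perm (l.erase p) :=
      (List.perm_cons_erase ((List.mem_erase_of_ne hpq.symm).2 hq)).symm
    exact ((List.perm_append_singleton q _).trans h1).cons p |>.trans (List.perm_cons_erase hp).symm
  refine ⟨p :: ((l.erase p).erase q ++ [q]), ⟨?_, rfl, by rw [← List.cons_append, List.getLast?_append]; simp⟩, hperm⟩
  apply List.Pairwise.isChain
  have hn := hperm.nodup_iff.2 hl
  exact hn.imp_of_mem fun {a b} ha hb hab =>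
    h _ (hperm.mem_iff.1 ha) _ (hperm.mem_iff.1 hb) hab

/-- The vertex list `C` of a cycle, up to a rotation, falls into four walks `S`, `M`, `T`, `N`. -/
structure CyclicQuad (G : SimpleGraph W) (C S M T N : List W) (x y m m' x' y' n n' : W) :
    Prop where
  trS : G.Traces x S y
  adjSM : G.Adj y m
  trM : G.Traces m M m'
  adjMT : G.Adj m' x'
  trT : G.Traces x' T y'
  adjTN : G.Adj y' n
  trN : G.Traces n N n'
  adjNS : G.Adj n' x
  perm : (S ++ M ++ T ++ N).Perm C

variable {C S M T N : List W} {x y m m' x' y' n n' : W}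

theorem CyclicQuad.rot (h : G.CyclicQuad C S M T N x y m m' x' y' n n') :
    G.CyclicQuad C T N S M x' y' n n' x y m m' where
  trS := h.trT
  adjSM := h.adjTN
  trM := h.trN
  adjMT := h.adjNS
  trT := h.trS
  adjTN := h.adjSM
  trN := h.trM
  adjNS := h.adjMT
  perm := by
    classical
    refine List.Perm.trans ?_ h.perm
    rw [List.perm_iff_count]
    intro a
    simp only [List.count_append]
    omega

theorem CyclicQuad.rev (h : G.CyclicQuad C S M T N x y m m' x' y' n n') :
    G.CyclicQuad C S.reverse N.reverse T.reverse M.reverse y x n' n y' x' m' m where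
  trS := h.trS.reverse
  adjSM := h.adjNS.symm
  trM := h.trN.reverse
  adjMT := h.adjTN.symm
  trT := h.trT.reverse
  adjTN := h.adjMT.symm
  trN := h.trM.reverse
  adjNS := h.adjSM.symm
  perm := by
    classical
    refine List.Perm.trans ?_ h.perm
    rw [List.perm_iff_count]
    intro a
    simp only [List.count_append, List.count_reverse]
    omega

/-- `C` is the vertex list of a cycle, and no cycle of `G` is longer. -/
structure IsLongestCycle (G : SimpleGraph W) (C : List W) : Prop where
  cyc : G.IsCyclicList C
  nodup : C.Nodup
  max : ∀ l, G.IsCyclicList l → l.Nodup → l.length ≤ C.length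

/-- A closed walk made of vertices of a longest cycle and of further distinct vertices is not
longer than the cycle. -/
theorem IsLongestCycle.length_le (hC : G.IsLongestCycle C) {hl l r : List W} (hn : hl.Nodup)
    (hd : ∀ z ∈ hl, z ∉ C) (h : G.IsCyclicList l) (hp : (l ++ r).Perm (C ++ hl)) :
    hl.length ≤ r.length := by
  have h1 : (C ++ hl).Nodup := List.nodup_append.2 ⟨hC.nodup, hn, by
    rintro a ha b hb rfl
    exact hd a hb ha⟩
  have h2 := hC.max l h (List.Nodup.of_append_left (hp.nodup_iff.2 h1))
  have h3 := hp.length_eq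
  simp only [List.length_append] at h3
  omega

/-- An edge between two segments of a longest cycle cannot start early in both of them. -/
theorem CyclicQuad.length_le_of_adj (h : G.CyclicQuad C S M T N x y m m' x' y' n n')
    (hC : G.IsLongestCycle C) {hl l₁ l₂ t₁ t₂ : List W} {p q u w : W}
    (hn : hl.Nodup) (hd : ∀ z ∈ hl, z ∉ C) (hp : G.Traces p hl q) (e₁ : G.Adj n' p)
    (e₂ : G.Adj q m') (hS : S = l₁ ++ u :: l₂) (hT : T = t₁ ++ w :: t₂) (huw : G.Adj u w) :
    hl.length ≤ l₁.length + t₁.length := by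
  classical
  have hS' : G.Traces u (u :: l₂) y := by
    by_cases h0 : l₁ = []
    · have := h.trS; rw [hS, h0] at this
      have h1 := this.head_eq
      subst h1; exact this
    · have := h.trS; rw [hS] at this
      obtain ⟨_, _, -, -, h2⟩ := this.split h0 (by simp)
      have h1 := h2.head_eq
      subst h1; exact h2
  have hT' : G.Traces w (w :: t₂) y' := by
    by_cases h0 : t₁ = []
    · have := h.trT; rw [hT, h0] at this
      have h1 := this.head_eq
      subst h1; exact this
    · have := h.trT; rw [hT] at this
      obtain ⟨_, _, -, -, h2⟩ := this.split h0 (by simp)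
      have h1 := h2.head_eq
      subst h1; exact h2
  -- Detour, `M` backwards, the rest of `S` backwards, the edge `uw`, the rest of `T`, then `N`:
  -- only `l₁` and `t₁` are lost.
  have hcyc := (((hp.append e₂ h.trM.reverse).append h.adjSM.symm hS'.reverse).append huw
    hT').append h.adjTN h.trN
  have := hC.length_le (r := l₁ ++ t₁) hn hd ⟨_, _, hcyc, e₁⟩ (by
    refine List.Perm.trans ?_ (h.perm.append_right hl)
    rw [List.perm_iff_count]
    intro a
    simp only [List.count_append, List.count_reverse, hS, hT, List.count_cons]
    omega)
  simpa using this

end CyclicLists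

/-! ### Cutting a longest cycle into segments -/

section Segments

variable {W : Type*} {G : SimpleGraph W}

/-- Built from the right: the prefix `pre` found so far becomes the segment of the next vertex of
`A`. Distinctness of the vertices ensures that this update of `S` overwrites no earlier segment. -/
theorem exists_segments [DecidableEq W] (A : Set W) (l : List W) (hl : l.Nodup) :
    ∃ (pre as : List W) (S : W → List W), l = pre ++ as.flatMap (fun a => a :: S a) ∧
      (∀ z ∈ pre, z ∉ A) ∧ (∀ a ∈ as, a ∈ A) ∧ ∀ a ∈ as, ∀ z ∈ S a, z ∉ A := by
  induction l with
  | nil => exact ⟨[], [], fun _ => [], by simp⟩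
  | cons x l ih =>
    obtain ⟨pre, as, S, h, h₁, h₂, h₃⟩ := ih hl.of_cons
    by_cases hx : x ∈ A
    · have hxl : ∀ a ∈ as, a ≠ x := by
        rintro a ha rfl
        apply (List.nodup_cons.1 hl).1
        rw [h]
        exact List.mem_append_right _ (List.mem_flatMap.2 ⟨a, ha, by simp⟩)
      refine ⟨[], x :: as, Function.update S x pre, ?_, by simp, ?_, ?_⟩
      · rw [List.flatMap_cons, Function.update_self, h]
        simp only [List.nil_append, List.cons_append, List.cons.injEq, true_and,
          List.append_cancel_left_eq]
        apply List.flatMap_congr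
        intro a ha
        rw [Function.update_of_ne (hxl a ha)]
      · simpa using ⟨hx, h₂⟩
      · intro a ha z hz
        rcases List.mem_cons.1 ha with rfl | ha
        · rw [Function.update_self] at hz
          exact h₁ z hz
        · rw [Function.update_of_ne (hxl a ha)] at hz
          exact h₃ a ha z hz
    · refine ⟨x :: pre, as, S, by simp [h], ?_, h₂, h₃⟩
      simpa using ⟨hx, h₁⟩

/-- The walk `N` from `n` to `n'` runs to `c`, then through `U`, then from `c'` on. -/
structure PassesThrough (G : SimpleGraph W) (N U N₁ N₂ : List W) (n n' c x y c' : W) : Prop where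
  eq : N = N₁ ++ U ++ N₂
  tr₁ : G.Traces n N₁ c
  adj₁ : G.Adj c x
  tr : G.Traces x U y
  adj₂ : G.Adj y c'
  tr₂ : G.Traces c' N₂ n'

theorem PassesThrough.rev {N U N₁ N₂ : List W} {n n' c x y c' : W}
    (h : G.PassesThrough N U N₁ N₂ n n' c x y c') :
    G.PassesThrough N.reverse U.reverse N₂.reverse N₁.reverse n' n c' y x c where
  eq := by simp [h.eq]
  tr₁ := h.tr₂.reverse
  adj₁ := h.adj₂.symm
  tr := h.tr.reverse
  adj₂ := h.adj₁.symm
  tr₂ := h.tr₁.reverse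

theorem Traces.head_mem_of_flatMap {S : W → List W} {as : List W} {b m q : W}
    (h : G.Traces m (as.flatMap (fun a => a :: S a) ++ [b]) q) : m ∈ as ++ [b] := by
  cases as with
  | nil => simpa using h.head_eq
  | cons a as =>
    rw [List.flatMap_cons, List.cons_append, List.cons_append] at h
    simp [h.head_eq]

theorem Traces.passesThrough {S : W → List W} {as : List W} {b c m : W}
    (h : G.Traces m (as.flatMap (fun a => a :: S a) ++ [b]) b) (hc : c ∈ as) (hS : S c ≠ []) :
    ∃ N₁ N₂ x y c', c' ∈ as ++ [b] ∧
      G.PassesThrough (as.flatMap (fun a => a :: S a) ++ [b]) (S c) N₁ N₂ m b c x y c' := by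
  obtain ⟨B₁, B₂, rfl⟩ := List.append_of_mem hc
  have heq : (B₁ ++ c :: B₂).flatMap (fun a => a :: S a) ++ [b] =
      (B₁.flatMap (fun a => a :: S a) ++ [c]) ++
        (S c ++ (B₂.flatMap (fun a => a :: S a) ++ [b])) := by
    simp [List.flatMap_append, List.flatMap_cons]
  rw [heq] at h ⊢
  obtain ⟨p, q, h₁, e₁, h₂⟩ := h.split (by simp) (by simp)
  obtain ⟨r, c', h₃, e₂, h₄⟩ := h₂.split hS (by simp)
  have hp := h₁.last_eq
  subst hp
  refine ⟨_, _, q, r, c', ?_, by simp, h₁, e₁, h₃, e₂, h₄⟩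
  have := h₄.head_mem_of_flatMap
  simp only [List.mem_append, List.mem_cons] at this ⊢
  tauto

/-- The vertex list `C` of a longest cycle is cut by its vertices in `as` into the
segments `S a`, where `S a` follows `a`. -/
structure IsSegmented (G : SimpleGraph W) (C as : List W) (S : W → List W) : Prop
    extends G.IsLongestCycle C where
  eq : C = as.flatMap (fun a => a :: S a)

variable {C as : List W} {S : W → List W}

theorem IsSegmented.mem_of_mem (h : G.IsSegmented C as S) {a : W} (ha : a ∈ as) : a ∈ C := by
  rw [h.eq]
  exact List.mem_flatMap.2 ⟨a, ha, by simp⟩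

theorem IsSegmented.mem_of_mem_segment (h : G.IsSegmented C as S) {a z : W} (ha : a ∈ as)
    (hz : z ∈ S a) : z ∈ C := by
  rw [h.eq]
  exact List.mem_flatMap.2 ⟨a, ha, by simp [hz]⟩

theorem IsSegmented.mem_iff (h : G.IsSegmented C as S) {z : W} :
    z ∈ C ↔ z ∈ as ∨ ∃ a ∈ as, z ∈ S a := by
  conv_lhs => rw [h.eq]
  rw [List.mem_flatMap]
  constructor
  · rintro ⟨a, ha, hz⟩
    rcases List.mem_cons.1 hz with rfl | hz
    · exact .inl ha
    · exact .inr ⟨a, ha, hz⟩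
  · rintro (hz | ⟨a, ha, hz⟩)
    · exact ⟨z, hz, by simp⟩
    · exact ⟨a, ha, by simp [hz]⟩

theorem IsSegmented.segment_nodup (h : G.IsSegmented C as S) {a : W} (ha : a ∈ as) :
    (S a).Nodup := by
  have := h.nodup
  rw [h.eq, List.nodup_flatMap] at this
  exact (this.1 a ha).of_cons

theorem IsSegmented.as_nodup (h : G.IsSegmented C as S) : as.Nodup := by
  have := h.nodup
  rw [h.eq, List.nodup_flatMap] at this
  refine this.2.imp ?_
  rintro a b hab rfl
  exact hab (show a ∈ a :: S a by simp) (show a ∈ a :: S a by simp)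

theorem IsSegmented.disjoint (h : G.IsSegmented C as S) {a b : W} (ha : a ∈ as) (hb : b ∈ as)
    (hab : a ≠ b) : List.Disjoint (a :: S a) (b :: S b) := by
  have := h.nodup
  rw [h.eq, List.nodup_flatMap] at this
  have _symm : Std.Symm (Function.onFun List.Disjoint fun a => a :: S a) := ⟨fun _ _ h => h.symm⟩
  exact this.2.forall ha hb hab

theorem IsSegmented.not_mem_segment (h : G.IsSegmented C as S) {a b : W} (ha : a ∈ as)
    (hb : b ∈ as) : a ∉ S b := by
  by_cases hab : a = b
  · subst hab
    have := h.nodup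
    rw [h.eq, List.nodup_flatMap] at this
    exact (List.nodup_cons.1 (this.1 a ha)).1
  · exact fun hz => h.disjoint ha hb hab (List.mem_cons_self) (List.mem_cons_of_mem _ hz)

theorem IsSegmented.eq_of_mem (h : G.IsSegmented C as S) {a b z : W} (ha : a ∈ as)
    (hb : b ∈ as) (hza : z ∈ S a) (hzb : z ∈ S b) : a = b := by
  by_contra hab
  exact h.disjoint ha hb hab (List.mem_cons_of_mem _ hza) (List.mem_cons_of_mem _ hzb)

theorem IsSegmented.length_eq [DecidableEq W] (h : G.IsSegmented C as S) :
    C.length = ∑ a ∈ as.toFinset, ((S a).length + 1) := by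
  rw [List.sum_toFinset _ h.as_nodup]
  conv_lhs => rw [h.eq]
  simp [List.length_flatMap]

theorem IsSegmented.exists_rotate (h : G.IsSegmented C as S) {a : W} (ha : a ∈ as) :
    ∃ bs, (a :: bs).Perm as ∧ G.IsCyclicList ((a :: bs).flatMap (fun a => a :: S a)) ∧
      ((a :: bs).flatMap (fun a => a :: S a)).Perm C := by
  obtain ⟨P₁, P₂, rfl⟩ := List.append_of_mem ha
  have hp : (a :: (P₂ ++ P₁)).Perm (P₁ ++ a :: P₂) :=
    (List.perm_append_comm (l₁ := a :: P₂) (l₂ := P₁))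
  refine ⟨P₂ ++ P₁, hp, ?_, ?_⟩
  · have := h.cyc
    rw [h.eq, List.flatMap_append] at this
    simpa [List.flatMap_append] using this.rotate
  · rw [h.eq]
    exact hp.flatMap_right _

/-- Two segments cut the cycle into four walks; each further segment lies in one of the two
walks between them. -/
theorem IsSegmented.exists_quad (h : G.IsSegmented C as S) (hS : ∀ a ∈ as, S a ≠ [])
    {a b : W} (ha : a ∈ as) (hb : b ∈ as) (hab : a ≠ b) :
    ∃ M N x y m x' y' n, G.CyclicQuad C (S a) M (S b) N x y m b x' y' n a ∧ m ∈ as ∧ n ∈ as ∧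
      ∀ c ∈ as, c ≠ a → c ≠ b → ∃ N₁ N₂ u v c', c' ∈ as ∧
        (G.PassesThrough M (S c) N₁ N₂ m b c u v c' ∨
          G.PassesThrough N (S c) N₁ N₂ n a c u v c') := by
  obtain ⟨bs, hp, hcyc, hperm⟩ := h.exists_rotate ha
  have hb' : b ∈ bs := by
    rcases List.mem_cons.1 (hp.mem_iff.2 hb) with h | h
    · exact absurd h.symm hab
    · exact h
  obtain ⟨A₁, A₂, rfl⟩ := List.append_of_mem hb'
  -- Rotating the leading `a` to the end leaves `S a`, a walk `M` ending in `b`, then `S b`, and a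
  -- walk `N` ending in `a`.
  have heq : ((a :: (A₁ ++ b :: A₂)).flatMap (fun a => a :: S a)) =
      [a] ++ ((S a ++ (A₁.flatMap (fun a => a :: S a) ++ [b])) ++
        (S b ++ A₂.flatMap (fun a => a :: S a))) := by
    simp [List.flatMap_append, List.flatMap_cons]
  rw [heq] at hcyc hperm
  have hcyc := hcyc.rotate
  rw [List.append_assoc, List.append_assoc (S b)] at hcyc
  obtain ⟨x, p, q, r, h₁, e₁, h₂, e₂⟩ := hcyc.split (by simp) (by simp)
  obtain ⟨y, m, h₃, e₃, h₄⟩ := h₁.split (hS a ha) (by simp)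
  obtain ⟨y', n, h₅, e₄, h₆⟩ := h₂.split (hS b hb) (by simp)
  have hp' := h₄.last_eq
  subst hp'
  have hr := h₆.last_eq
  subst hr
  have hm := h₄.head_mem_of_flatMap
  have hn := h₆.head_mem_of_flatMap
  have hsub₁ : ∀ z ∈ A₁ ++ [p], z ∈ as := fun z hz => hp.mem_iff.1 (by
    simp only [List.mem_append, List.mem_cons] at hz ⊢; tauto)
  have hsub₂ : ∀ z ∈ A₂ ++ [r], z ∈ as := fun z hz => hp.mem_iff.1 (by
    simp only [List.mem_append, List.mem_cons] at hz ⊢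
    rcases hz with hz | hz | hz
    · tauto
    · tauto
    · simp at hz)
  refine ⟨_, _, x, y, m, q, y', n, ⟨h₃, e₃, h₄, e₁, h₅, e₄, h₆, e₂, ?_⟩, hsub₁ m hm, hsub₂ n hn, ?_⟩
  · refine List.Perm.trans ?_ hperm
    classical
    rw [List.perm_iff_count]
    intro z
    simp only [List.count_append]
    omega
  · intro c hc hca hcb
    have := hp.mem_iff.2 hc
    simp only [List.mem_append, List.mem_cons, hca, hcb, false_or] at this
    rcases this with hc' | hc'
    · obtain ⟨N₁, N₂, u, v, c', hc'', H⟩ := h₄.passesThrough hc' (hS c hc)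
      exact ⟨N₁, N₂, u, v, c', hsub₁ _ hc'', .inl H⟩
    · obtain ⟨N₁, N₂, u, v, c', hc'', H⟩ := h₆.passesThrough hc' (hS c hc)
      exact ⟨N₁, N₂, u, v, c', hsub₂ _ hc'', .inr H⟩

/-- A detour between a cutting vertex and the next one is not longer than the segment that it
avoids. -/
theorem IsSegmented.exists_next (h : G.IsSegmented C as S) (has : 2 ≤ as.length) {a : W}
    (ha : a ∈ as) : ∃ b ∈ as, b ≠ a ∧ ∀ (hl : List W) (p q : W), hl.Nodup → (∀ z ∈ hl, z ∉ C) →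
      G.Traces p hl q → G.Adj a p → G.Adj q b → hl.length ≤ (S a).length := by
  obtain ⟨bs, hp, hcyc, hperm⟩ := h.exists_rotate ha
  cases bs with
  | nil => have := hp.length_eq; simp at this; omega
  | cons b bs =>
    have hba : b ≠ a := by
      have := hp.nodup_iff.2 h.as_nodup
      simp only [List.nodup_cons, List.mem_cons, not_or] at this
      exact fun h => this.1.1 h.symm
    refine ⟨b, hp.mem_iff.1 (by simp), hba, ?_⟩
    intro hl p q hn hd ht e₁ e₂
    have heq : ((a :: b :: bs).flatMap (fun a => a :: S a)) =
        [a] ++ (S a ++ ((b :: bs).flatMap (fun a => a :: S a))) := by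
      simp [List.flatMap_cons]
    rw [heq] at hcyc hperm
    have hT : ∃ z, G.Traces b ((b :: bs).flatMap (fun a => a :: S a)) z ∧ G.Adj z a := by
      obtain ⟨u, p, q, v, h₁, e₁, h₂, e₂⟩ := hcyc.split (by simp) (by simp)
      have hu := h₁.head_eq
      subst hu
      -- Empty segments cannot be excluded here, since this lemma is what excludes them later.
      by_cases hSa : S u = []
      · rw [hSa, List.nil_append] at h₂
        have := h₂
        rw [List.flatMap_cons, List.cons_append] at this
        rw [this.head_eq] at h₂
        exact ⟨v, h₂, e₂⟩
      · obtain ⟨_, r, -, -, h₃⟩ := h₂.split hSa (by simp)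
        have := h₃
        rw [List.flatMap_cons, List.cons_append] at this
        rw [this.head_eq] at h₃
        exact ⟨v, h₃, e₂⟩
    obtain ⟨z, hz, e₃⟩ := hT
    refine h.length_le hn hd ⟨_, _, ((Traces.single a).append e₁ ht).append e₂ hz, e₃⟩ ?_
    classical
    refine List.Perm.trans ?_ (hperm.append_right hl)
    rw [List.perm_iff_count]
    intro z
    simp only [List.count_append]
    omega

/-- A vertex off a longest cycle is not adjacent to two consecutive vertices of it. -/
theorem IsLongestCycle.not_adj_of_adj (hC : G.IsLongestCycle C) {l₁ l₂ : List W} {r u w : W}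
    (hl : C = l₁ ++ u :: w :: l₂) (hr : r ∉ C) (hu : G.Adj r u) : ¬ G.Adj r w := by
  intro hw
  have h : G.IsCyclicList ([u] ++ (w :: l₂ ++ l₁)) := by
    have := hC.cyc
    rw [hl] at this
    simpa using this.rotate
  obtain ⟨u', p, q, v, h₁, e₁, h₂, e₂⟩ := h.split (by simp) (by simp)
  have e₃ := h₂.head_eq
  have e₄ := h₁.head_eq
  subst e₃ e₄
  have := hC.length_le (hl := [r]) (r := []) (by simp) (by simpa using hr)
    ⟨_, _, ((Traces.single r).append hw h₂).append e₂ (Traces.single u'), hu.symm⟩ (by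
      classical
      rw [hl, List.perm_iff_count]
      intro z
      simp only [List.count_append, List.count_cons, List.count_nil]
      omega)
  simp at this

end Segments

/-! ### A component off the cycle: number of cuts, clique structure, long detours -/

section Attached

variable {W : Type*} {G : SimpleGraph W}

theorem CyclicQuad.nodup {C S M T N : List W} {x y m m' x' y' n n' : W}
    (h : G.CyclicQuad C S M T N x y m m' x' y' n n') (hC : C.Nodup) :
    (S ++ M ++ T ++ N).Nodup :=
  h.perm.nodup_iff.2 hC

/-- A longest cycle, segmented at the attachment vertices of a component `H` of its complement,
in a graph that no fewer than `K` vertices separate and whose independent sets have at most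
`K + 1` elements. -/
structure IsAttached (G : SimpleGraph W) (C as : List W) (S : W → List W) (H : Finset W)
    (K : ℕ) : Prop extends G.IsSegmented C as S where
  two_le : 2 ≤ K
  two_le_length : 2 ≤ C.length
  nonempty : H.Nonempty
  conn : ∀ p ∈ H, ∀ q ∈ H, ∃ hl, G.Traces p hl q ∧ hl.Nodup ∧ ∀ z ∈ hl, z ∈ H
  off : ∀ p ∈ H, p ∉ C
  att : ∀ a ∈ as, ∃ p ∈ H, G.Adj a p
  nbr : ∀ p ∈ H, ∀ w ∉ H, G.Adj p w → w ∈ as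
  sep : ∀ Z : Finset W, Z.card < K → ∀ X : Set W, (∃ p ∈ X, p ∉ Z) →
    (∀ u ∈ X, u ∉ Z → ∀ w ∉ Z, G.Adj u w → w ∈ X) → ∀ q ∉ Z, q ∈ X
  indep : ∀ s : Finset W, (∀ u ∈ s, ∀ v ∈ s, ¬ G.Adj u v) → s.card ≤ K + 1

/-- Any two cutting vertices are joined by a detour off the cycle with at least `d` inner
vertices. -/
def Linked (G : SimpleGraph W) (C as : List W) (d : ℕ) : Prop :=
  ∀ a ∈ as, ∀ b ∈ as, a ≠ b → ∃ hl p q, hl.Nodup ∧ (∀ z ∈ hl, z ∉ C) ∧ G.Traces p hl q ∧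
    G.Adj a p ∧ G.Adj q b ∧ d ≤ hl.length

variable {C as : List W} {S : W → List W} {H : Finset W} {K d : ℕ}

/-- Connectedness of `H` alone gives this weak bound. It suffices for nonempty segments and
nonadjacent first vertices, from which `H` turns out to be a clique and the bound improves to
`H.card`. -/
theorem IsAttached.linked_one (h : G.IsAttached C as S H K) : G.Linked C as 1 := by
  intro a ha b hb _
  obtain ⟨p, hp, e₁⟩ := h.att a ha
  obtain ⟨q, hq, e₂⟩ := h.att b hb
  obtain ⟨hl, ht, hn, hH⟩ := h.conn p hp q hq
  exact ⟨hl, p, q, hn, fun z hz => h.off z (hH z hz), ht, e₁, e₂.symm,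
    List.length_pos_iff.2 ht.ne_nil⟩

theorem Linked.le_length (hd : G.Linked C as d) (h : G.IsSegmented C as S)
    (has : 2 ≤ as.length) {a : W} (ha : a ∈ as) : d ≤ (S a).length := by
  obtain ⟨b, hb, hba, hmax⟩ := h.exists_next has ha
  obtain ⟨hl, p, q, hn, hoff, ht, e₁, e₂, hle⟩ := hd a ha b hb hba.symm
  exact hle.trans (hmax hl p q hn hoff ht e₁ e₂)

/-- An edge between two segments of a longest cycle starts neither early in both nor late in
both of them. -/
theorem Linked.le_of_adj (hd : G.Linked C as d) (h : G.IsSegmented C as S)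
    (hS : ∀ a ∈ as, S a ≠ []) {a b : W} (ha : a ∈ as) (hb : b ∈ as) (hab : a ≠ b)
    {l₁ l₂ t₁ t₂ : List W} {u w : W} (hu : S a = l₁ ++ u :: l₂) (hw : S b = t₁ ++ w :: t₂)
    (huw : G.Adj u w) : d ≤ l₁.length + t₁.length ∧ d ≤ l₂.length + t₂.length := by
  obtain ⟨M, N, x, y, m, x', y', n, hQ, hm, hn, -⟩ := h.exists_quad hS ha hb hab
  constructor
  · obtain ⟨hl, p, q, hnd, hoff, ht, e₁, e₂, hle⟩ := hd a ha b hb hab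
    exact hle.trans (hQ.length_le_of_adj h.toIsLongestCycle hnd hoff ht e₁ e₂ hu hw huw)
  -- The second bound is the first one on the reversed cycle, where the detour joins the vertices
  -- `m` and `n` that follow the two segments.
  · have hmn : m ≠ n := by
      rintro rfl
      have := hQ.nodup h.nodup
      rw [List.append_assoc, List.append_assoc, List.nodup_append] at this
      have := this.2.1
      rw [List.nodup_append] at this
      exact this.2.2 m hQ.trM.head_mem m (List.mem_append_right _ hQ.trN.head_mem) rfl
    obtain ⟨hl, p, q, hnd, hoff, ht, e₁, e₂, hle⟩ := hd m hm n hn hmn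
    have := hQ.rev.length_le_of_adj h.toIsLongestCycle hnd hoff ht e₁ e₂
      (l₁ := l₂.reverse) (l₂ := l₁.reverse) (t₁ := t₂.reverse) (t₂ := t₁.reverse)
      (u := u) (w := w) (by simp [hu]) (by simp [hw]) huw
    simp only [List.length_reverse] at this
    exact hle.trans this

theorem IsAttached.segment_ne_nil_of_two_le (h : G.IsAttached C as S H K)
    (has : 2 ≤ as.length) {a : W} (ha : a ∈ as) : S a ≠ [] := by
  have := h.linked_one.le_length h.toIsSegmented has ha
  exact List.length_pos_iff.1 this

theorem IsAttached.not_adj_segment (h : G.IsAttached C as S H K) {a p z : W} (ha : a ∈ as)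
    (hz : z ∈ S a) (hp : p ∈ H) : ¬ G.Adj p z := by
  intro hadj
  refine h.not_mem_segment (h.nbr p hp z ?_ hadj) ha hz
  exact fun hzH => h.off z hzH (h.mem_of_mem_segment ha hz)

theorem IsAttached.ne_of_mem_segment (h : G.IsAttached C as S H K) {a p z : W} (ha : a ∈ as)
    (hz : z ∈ S a) (hp : p ∈ H) : z ≠ p := by
  rintro rfl
  exact h.off z hp (h.mem_of_mem_segment ha hz)

variable [DecidableEq W]

/-- Fewer than `K` cuts separate nothing, so everything outside the cuts would lie in `H` and all
segments would be empty. The cycle then consists of at least two cuts, and a detour between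
consecutive ones lengthens it. -/
theorem IsAttached.le_length_as (h : G.IsAttached C as S H K) : K ≤ as.length := by
  by_contra hlt
  have hcard : as.toFinset.card < K := by
    rw [List.toFinset_card_of_nodup h.as_nodup]; omega
  obtain ⟨p, hp⟩ := h.nonempty
  have hall : ∀ q ∉ as.toFinset, q ∈ (H : Set W) := by
    refine h.sep _ hcard _ ⟨p, hp, ?_⟩ ?_
    · rw [List.mem_toFinset]
      exact fun h' => h.off p hp (h.mem_of_mem h')
    · intro u hu _ w hw hadj
      by_contra hwH
      exact hw (List.mem_toFinset.2 (h.nbr u hu w hwH hadj))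
  have hS : ∀ a ∈ as, S a = [] := by
    intro a ha
    rw [List.eq_nil_iff_forall_not_mem]
    intro z hz
    refine h.off z (hall z ?_) (h.mem_of_mem_segment ha hz)
    rw [List.mem_toFinset]
    exact fun hz' => h.not_mem_segment hz' ha hz
  have hlen : C.length = as.length := by
    rw [h.length_eq, Finset.sum_congr rfl (g := fun _ => 1), Finset.sum_const,
      List.toFinset_card_of_nodup h.as_nodup]
    · simp
    · intro a ha
      rw [hS a (List.mem_toFinset.1 ha)]
      rfl
  have h2 := h.two_le_length
  have hpos : 0 < as.length := by omega
  obtain ⟨a, ha⟩ := List.exists_mem_of_length_pos hpos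
  exact h.segment_ne_nil_of_two_le (by omega) ha (hS a ha)

theorem IsAttached.two_le_length_as (h : G.IsAttached C as S H K) : 2 ≤ as.length :=
  h.two_le.trans h.le_length_as

theorem IsAttached.segment_ne_nil (h : G.IsAttached C as S H K) {a : W} (ha : a ∈ as) :
    S a ≠ [] :=
  h.segment_ne_nil_of_two_le h.two_le_length_as ha

/-- Segments are disjoint, so their representatives are distinct and form an independent set with
`T`. Every use of the independence bound goes through this count. -/
theorem IsAttached.card_add_card_le (h : G.IsAttached C as S H K) {I : Finset W} {z : W → W}
    {T : Finset W} (hI : ∀ b ∈ I, b ∈ as) (hz : ∀ b ∈ I, z b ∈ S b)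
    (hzz : ∀ b ∈ I, ∀ c ∈ I, b ≠ c → ¬ G.Adj (z b) (z c))
    (hT : ∀ t ∈ T, ∀ t' ∈ T, ¬ G.Adj t t')
    (hzT : ∀ b ∈ I, ∀ t ∈ T, z b ≠ t ∧ ¬ G.Adj (z b) t) : I.card + T.card ≤ K + 1 := by
  have hinj : Set.InjOn z I := by
    intro b hb c hc hbc
    exact h.eq_of_mem (hI b hb) (hI c hc) (hz b hb) (hbc ▸ hz c hc)
  rw [← Finset.card_image_of_injOn hinj, ← Finset.card_union_of_disjoint]
  · apply h.indep
    intro u hu v hv hadj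
    rw [Finset.mem_union, Finset.mem_image] at hu hv
    rcases hu with ⟨b, hb, rfl⟩ | hu <;> rcases hv with ⟨c, hc, rfl⟩ | hv
    · by_cases hbc : b = c
      · exact hadj.ne (by rw [hbc])
      · exact hzz b hb c hc hbc hadj
    · exact (hzT b hb v hv).2 hadj
    · exact (hzT c hc u hu).2 hadj.symm
    · exact hT u hu v hv hadj
  · rw [Finset.disjoint_left]
    intro u hu hu'
    obtain ⟨b, hb, rfl⟩ := Finset.mem_image.1 hu
    exact (hzT b hb _ hu').1 rfl

/-- The first vertices of the segments are pairwise nonadjacent. -/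
theorem IsAttached.exists_heads (h : G.IsAttached C as S H K) :
    ∃ z : W → W, (∀ b ∈ as, ∃ l, S b = z b :: l) ∧
      ∀ b ∈ as, ∀ c ∈ as, b ≠ c → ¬ G.Adj (z b) (z c) := by
  have hex : ∀ b, ∃ z, b ∈ as → ∃ l, S b = z :: l := by
    intro b
    by_cases hb : b ∈ as
    · obtain ⟨z, l, hl⟩ := List.exists_cons_of_ne_nil (h.segment_ne_nil hb)
      exact ⟨z, fun _ => ⟨l, hl⟩⟩
    · exact ⟨b, fun h => absurd h hb⟩
  choose z hz using hex
  refine ⟨z, hz, ?_⟩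
  intro b hb c hc hbc hadj
  obtain ⟨l, hl⟩ := hz b hb
  obtain ⟨t, ht⟩ := hz c hc
  have := (h.linked_one.le_of_adj h.toIsSegmented (fun a ha => h.segment_ne_nil ha) hb hc hbc
    (l₁ := []) (t₁ := []) hl ht hadj).1
  simp at this

/-- `H` has no edges to the segments, so `T` can be added to their first vertices. One vertex of `H`
gives exactly `K` cuts; two nonadjacent ones are then impossible. -/
theorem IsAttached.length_as_add_card_le (h : G.IsAttached C as S H K) {T : Finset W}
    (hTH : T ⊆ H) (hT : ∀ t ∈ T, ∀ t' ∈ T, ¬ G.Adj t t') : as.length + T.card ≤ K + 1 := by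
  obtain ⟨z, hz, hzz⟩ := h.exists_heads
  have hmem : ∀ b ∈ as, z b ∈ S b := by
    intro b hb
    obtain ⟨l, hl⟩ := hz b hb
    simp [hl]
  rw [← List.toFinset_card_of_nodup h.as_nodup]
  refine h.card_add_card_le (z := z) (fun b hb => List.mem_toFinset.1 hb)
    (fun b hb => hmem b (List.mem_toFinset.1 hb))
    (fun b hb c hc => hzz b (List.mem_toFinset.1 hb) c (List.mem_toFinset.1 hc)) hT ?_
  intro b hb t ht
  have hb' := List.mem_toFinset.1 hb
  exact ⟨h.ne_of_mem_segment hb' (hmem b hb') (hTH ht),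
    fun hadj => h.not_adj_segment hb' (hmem b hb') (hTH ht) hadj.symm⟩

theorem IsAttached.length_as (h : G.IsAttached C as S H K) : as.length = K := by
  obtain ⟨p, hp⟩ := h.nonempty
  have := h.length_as_add_card_le (T := {p}) (by simpa using hp) (by simp)
  have := h.le_length_as
  simp only [Finset.card_singleton] at *
  omega

theorem IsAttached.adj_of_mem (h : G.IsAttached C as S H K) {p q : W} (hp : p ∈ H)
    (hq : q ∈ H) (hpq : p ≠ q) : G.Adj p q := by
  by_contra hadj
  have := h.length_as_add_card_le (T := {p, q})
    (by simp [Finset.insert_subset_iff, hp, hq]) (by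
      have hadj' : ¬ G.Adj q p := fun e => hadj e.symm
      simp [hadj, hadj'])
  rw [Finset.card_pair hpq, h.length_as] at this
  omega

/-- If the `K` vertices of `B` separate `X` from some vertex, then any two vertices of `B` have
distinct neighbours in `X`. -/
theorem IsAttached.exists_distinct_nbrs (h : G.IsAttached C as S H K) {X B : Finset W}
    (hB : B.card = K) (hX : 2 ≤ X.card) (hXB : ∀ z ∈ X, z ∉ B)
    (hXnbr : ∀ u ∈ X, ∀ w ∉ X, G.Adj u w → w ∈ B) (hne : ∃ q ∉ X, q ∉ B) {a b : W}
    (ha : a ∈ B) (hb : b ∈ B) (hab : a ≠ b) :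
    ∃ p ∈ X, ∃ q ∈ X, p ≠ q ∧ G.Adj a p ∧ G.Adj b q := by
  obtain ⟨r, hrX, hrB⟩ := hne
  have hone : ∀ c ∈ B, ∃ p ∈ X, G.Adj c p := by
    intro c hc
    by_contra! hno
    refine hrX ?_
    -- If `c` saw nothing of `X`, the `K - 1` other vertices of `B` would already separate.
    refine h.sep (B.erase c) (by
      rw [Finset.card_erase_of_mem hc, hB]
      have := h.two_le; omega) (X : Set W) ?_ ?_ r ?_
    · obtain ⟨p, hp⟩ := Finset.card_pos.1 (by omega : 0 < X.card)
      exact ⟨p, hp, fun h' => hXB p hp (Finset.mem_of_mem_erase h')⟩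
    · intro u hu _ w hw hadj
      by_contra hwX
      have hwB := hXnbr u hu w hwX hadj
      by_cases hwc : w = c
      · subst hwc
        exact hno u hu hadj.symm
      · exact hw (Finset.mem_erase.2 ⟨hwc, hwB⟩)
    · exact fun h' => hrB (Finset.mem_of_mem_erase h')
  by_contra! hno
  obtain ⟨p, hp, hap⟩ := hone a ha
  obtain ⟨q, hq, hbq⟩ := hone b hb
  have hpq : p = q := by
    by_contra hpq
    exact hno p hp q hq hpq hap hbq
  subst hpq
  have ha' : ∀ u ∈ X, G.Adj a u → u = p := fun u hu hau => by
    by_contra hup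
    exact hno u hu p hp hup hau hbq
  have hb' : ∀ u ∈ X, G.Adj b u → u = p := fun u hu hbu => by
    by_contra hup
    exact hno p hp u hu (fun e => hup e.symm) hap hbu
  refine hrX ?_
  -- Both `a` and `b` see only `p` in `X`. Replacing the two by `p` gives a set of at most `K - 1`
  -- vertices that still separates a second vertex of `X` from `r`.
  refine h.sep (insert p ((B.erase a).erase b)) (by
    have h1 : b ∈ B.erase a := Finset.mem_erase.2 ⟨hab.symm, hb⟩
    have h2 := Finset.card_insert_le p ((B.erase a).erase b)
    rw [Finset.card_erase_of_mem h1, Finset.card_erase_of_mem ha, hB] at h2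
    have := h.two_le
    omega) (X : Set W) ?_ ?_ r ?_
  · obtain ⟨u, hu, hup⟩ := Finset.exists_mem_ne (by omega : 1 < X.card) p
    refine ⟨u, hu, ?_⟩
    simp only [Finset.mem_insert, Finset.mem_erase, not_or]
    exact ⟨hup, fun h' => hXB u hu h'.2.2⟩
  · intro u hu huZ w hw hadj
    by_contra hwX
    have hwB := hXnbr u hu w hwX hadj
    simp only [Finset.mem_insert, Finset.mem_erase, not_or] at huZ hw
    by_cases hwa : w = a
    · subst hwa
      exact huZ.1 (ha' u hu hadj.symm)
    · by_cases hwb : w = b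
      · subst hwb
        exact huZ.1 (hb' u hu hadj.symm)
      · exact hw.2 ⟨hwb, hwa, hwB⟩
  · simp only [Finset.mem_insert, Finset.mem_erase, not_or]
    refine ⟨?_, fun h' => hrB h'.2.2⟩
    rintro rfl
    exact hrX hp

theorem IsAttached.card_toFinset (h : G.IsAttached C as S H K) : as.toFinset.card = K := by
  rw [List.toFinset_card_of_nodup h.as_nodup, h.length_as]

/-- The cuts separate `H`, so two of them have distinct neighbours in `H`, and the clique `H` can be
traversed completely between these. -/
theorem IsAttached.linked_card (h : G.IsAttached C as S H K) (hH : 2 ≤ H.card) :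
    G.Linked C as H.card := by
  intro a ha b hb hab
  have hne : ∃ q ∉ H, q ∉ as := by
    obtain ⟨z, hz⟩ := List.exists_mem_of_ne_nil _ (h.segment_ne_nil ha)
    exact ⟨z, fun hzH => h.off z hzH (h.mem_of_mem_segment ha hz),
      fun hzas => h.not_mem_segment hzas ha hz⟩
  obtain ⟨p, hp, q, hq, hpq, e₁, e₂⟩ := h.exists_distinct_nbrs (B := as.toFinset)
    h.card_toFinset hH
    (fun z hz hzas => h.off z hz (h.mem_of_mem (List.mem_toFinset.1 hzas)))
    (fun u hu w hw e => List.mem_toFinset.2 (h.nbr u hu w hw e)) (by simpa using hne)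
    (List.mem_toFinset.2 ha) (List.mem_toFinset.2 hb) hab
  obtain ⟨hl, ht, hperm⟩ := exists_traces_of_pairwise (G := G) H.nodup_toList
    (fun u hu v hv => h.adj_of_mem (Finset.mem_toList.1 hu) (Finset.mem_toList.1 hv))
    (Finset.mem_toList.2 hp) (Finset.mem_toList.2 hq) hpq
  refine ⟨hl, p, q, hperm.nodup_iff.2 H.nodup_toList, ?_, ht, e₁, e₂.symm, ?_⟩
  · intro z hz
    exact h.off z (Finset.mem_toList.1 (hperm.mem_iff.1 hz))
  · rw [hperm.length_eq, Finset.length_toList]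

end Attached

/-! ### Reroutings of the cycle that lose no vertex -/

section Rerouting

variable {W : Type*} {G : SimpleGraph W} {C S M T N hl : List W}
  {x y m m' x' y' n n' p q : W}

theorem IsLongestCycle.false_of_perm (hC : G.IsLongestCycle C) {l : List W} (hn : hl.Nodup)
    (hd : ∀ z ∈ hl, z ∉ C) (ht : G.Traces p hl q) (h : G.IsCyclicList l)
    (hp : l.Perm (C ++ hl)) : False := by
  have := hC.length_le (r := []) hn hd h (by simpa using hp)
  exact ht.ne_nil (List.length_eq_zero_iff.1 (by simpa using this))

/-- The exchange of `CyclicQuad.length_le_of_adj`, with `S` and `T` traversed in another order so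
that nothing is dropped. -/
theorem CyclicQuad.not_adj_of_perm (h : G.CyclicQuad C S M T N x y m m' x' y' n n')
    (hC : G.IsLongestCycle C) (hn : hl.Nodup) (hd : ∀ z ∈ hl, z ∉ C) (hp : G.Traces p hl q)
    (e₁ : G.Adj n' p) (e₂ : G.Adj q m') {S' T' : List W} {u w : W} (hS : S'.Perm S)
    (hT : T'.Perm T) (tS : G.Traces y S' u) (tT : G.Traces w T' y') : ¬ G.Adj u w := by
  intro huw
  refine hC.false_of_perm hn hd hp ⟨_, _, (((hp.append e₂ h.trM.reverse).append h.adjSM.symm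
    tS).append huw tT).append h.adjTN h.trN, e₁⟩ ?_
  classical
  refine List.Perm.trans ?_ (h.perm.append_right hl)
  rw [List.perm_iff_count]
  intro a
  have h₁ := hS.count_eq a
  have h₂ := hT.count_eq a
  simp only [List.count_append, List.count_reverse]
  omega

/-- If the last vertex of `S` is adjacent to the first vertex of `T`, then no end of the walk
between them is adjacent to a vertex from which `S` can be traversed towards its last vertex. -/
theorem CyclicQuad.not_adj_of_chord (h : G.CyclicQuad C S M T N x y m m' x' y' n n')
    (hC : G.IsLongestCycle C) (hn : hl.Nodup) (hd : ∀ z ∈ hl, z ∉ C) (hp : G.Traces p hl q)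
    (hyx : G.Adj y x') {M' S' : List W} {s t z : W} (hM : M'.Perm M) (tM : G.Traces s M' t)
    (hS : S'.Perm S) (tS : G.Traces z S' y) (e₁ : G.Adj n' p) (e₂ : G.Adj q s) :
    ¬ G.Adj t z := by
  intro htz
  refine hC.false_of_perm hn hd hp ⟨_, _, (((hp.append e₂ tM).append htz
    tS).append hyx h.trT).append h.adjTN h.trN, e₁⟩ ?_
  classical
  refine List.Perm.trans ?_ (h.perm.append_right hl)
  rw [List.perm_iff_count]
  intro a
  have h₁ := hS.count_eq a
  have h₂ := hM.count_eq a
  simp only [List.count_append]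
  omega

/-- If the last vertex of `S` is adjacent to the first vertex of `T`, then no end of the walk
between them is adjacent to a vertex from which a further segment can be traversed towards its
last vertex. -/
theorem CyclicQuad.not_adj_of_chord_of_passesThrough
    (h : G.CyclicQuad C S M T N x y m m' x' y' n n')
    (hC : G.IsLongestCycle C) (hn : hl.Nodup) (hd : ∀ z ∈ hl, z ∉ C) (hp : G.Traces p hl q)
    (hyx : G.Adj y x') {U N₁ N₂ M' U' : List W} {s t z c u v c' : W}
    (hN : G.PassesThrough N U N₁ N₂ n n' c u v c') (hM : M'.Perm M) (tM : G.Traces s M' t)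
    (hU : U'.Perm U) (tU : G.Traces z U' v) (e₁ : G.Adj c p) (e₂ : G.Adj q s) :
    ¬ G.Adj t z := by
  intro htz
  refine hC.false_of_perm hn hd hp ⟨_, _, ((((((hp.append e₂ tM).append htz tU).append hN.adj₂
    hN.tr₂).append h.adjNS h.trS).append hyx h.trT).append h.adjTN hN.tr₁), e₁⟩ ?_
  classical
  refine List.Perm.trans ?_ (h.perm.append_right hl)
  rw [List.perm_iff_count]
  intro a
  have h₁ := hU.count_eq a
  have h₂ := hM.count_eq a
  simp only [List.count_append, hN.eq]
  omega

/-- `M` is opened at `U`: both remaining parts are run backwards and linked at their outer ends by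
the detour, `U` is reinserted between `c'` and `n`, and after `N`, `S`, the edge `yx'` and `T` the
cycle closes at `c`. In the application `c` is the universal vertex. -/
theorem CyclicQuad.not_adj_of_passesThrough
    (h : G.CyclicQuad C S M T N x y m m' x' y' n n')
    (hC : G.IsLongestCycle C) (hn : hl.Nodup) (hd : ∀ z ∈ hl, z ∉ C) (hp : G.Traces p hl q)
    {U N₁ N₂ U' : List W} {z₁ z₂ c u v c' : W}
    (hM : G.PassesThrough M U N₁ N₂ m m' c u v c')
    (hU : U'.Perm U) (tU : G.Traces z₁ U' z₂) (e₁ : G.Adj m p) (e₂ : G.Adj q m')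
    (e₃ : G.Adj c' z₁) (e₄ : G.Adj z₂ n) (e₅ : G.Adj y' c) : ¬ G.Adj y x' := by
  intro hyx
  refine hC.false_of_perm hn hd hp ⟨_, _, ((((((hM.tr₁.reverse.append e₁ hp).append e₂
    hM.tr₂.reverse).append e₃ tU).append e₄ h.trN).append h.adjNS h.trS).append hyx h.trT), e₅⟩ ?_
  classical
  refine List.Perm.trans ?_ (h.perm.append_right hl)
  rw [List.perm_iff_count]
  intro a
  have h₁ := hU.count_eq a
  simp only [List.count_append, hM.eq, List.count_reverse]
  omega

end Rerouting

/-! ### Large `H`: the cycle and `H` cover the graph, and segments are cliques -/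

section Saturated

variable {W : Type*} {G : SimpleGraph W}

/-- The situation of a longest cycle through a universal vertex `o` that misses a large component
`H`, when no vertex has more than `|H| + K - 1` neighbours. -/
structure IsSaturated (G : SimpleGraph W) (C as : List W) (S : W → List W) (H : Finset W)
    (K : ℕ) (o : W) : Prop extends G.IsAttached C as S H K where
  mem_as : o ∈ as
  adj_univ : ∀ w, w ≠ o → G.Adj o w
  large : 2 * (K * (K - 1)) + 1 ≤ H.card
  total : C.length + H.card ≤ (K + 1) * (H.card + K - 1) + 1
  deg : ∀ w, w ≠ o → ∀ s : Finset W, (∀ u ∈ s, G.Adj w u) → s.card < H.card + K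

variable {C as : List W} {S : W → List W} {H : Finset W} {K : ℕ} {o : W}

theorem IsSegmented.exists_append (h : G.IsSegmented C as S) {a : W} (ha : a ∈ as) :
    ∃ l₁ l₂, C = l₁ ++ S a ++ l₂ := by
  obtain ⟨P₁, P₂, rfl⟩ := List.append_of_mem ha
  exact ⟨P₁.flatMap (fun a => a :: S a) ++ [a], P₂.flatMap (fun a => a :: S a), by
    simp [h.eq, List.flatMap_append, List.flatMap_cons]⟩

theorem IsSaturated.five_le (h : G.IsSaturated C as S H K o) : 5 ≤ H.card := by
  have h1 := h.large
  have h2 := h.two_le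
  have h3 : 2 * 1 ≤ K * (K - 1) := Nat.mul_le_mul h2 (by omega)
  omega

theorem exists_append_cons_of_lt {l : List W} {t : ℕ} (ht : t < l.length) :
    ∃ l₁ z l₂, l = l₁ ++ z :: l₂ ∧ l₁.length = t :=
  ⟨l.take t, l[t], l.drop (t + 1), by simp, by simp; omega⟩

variable [DecidableEq W]

theorem IsSaturated.linked (h : G.IsSaturated C as S H K o) : G.Linked C as H.card :=
  h.linked_card (by have := h.five_le; omega)

theorem IsSaturated.card_le_length (h : G.IsSaturated C as S H K o) {a : W} (ha : a ∈ as) :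
    H.card ≤ (S a).length :=
  h.linked.le_length h.toIsSegmented h.two_le_length_as ha

/-- By `total`, the cycle has at most `K * H.card + K * K` vertices. The `K` cuts and at least
`H.card` vertices in each of the other `K - 2` segments are subtracted. -/
theorem IsSaturated.length_add_length_le (h : G.IsSaturated C as S H K o) {a b : W}
    (ha : a ∈ as) (hb : b ∈ as) (hab : a ≠ b) :
    (S a).length + (S b).length ≤ 2 * H.card + K * (K - 1) := by
  have h1 := h.length_eq
  have hb' : b ∈ as.toFinset.erase a := Finset.mem_erase.2 ⟨hab.symm, List.mem_toFinset.2 hb⟩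
  rw [← Finset.add_sum_erase _ _ (List.mem_toFinset.2 ha), ← Finset.add_sum_erase _ _ hb'] at h1
  have h2 : ((as.toFinset.erase a).erase b).card • (H.card + 1) ≤
      ∑ c ∈ (as.toFinset.erase a).erase b, ((S c).length + 1) := by
    apply Finset.card_nsmul_le_sum
    intro c hc
    have := h.card_le_length (List.mem_toFinset.1 (Finset.mem_of_mem_erase
      (Finset.mem_of_mem_erase hc)))
    omega
  rw [Finset.card_erase_of_mem hb', Finset.card_erase_of_mem (List.mem_toFinset.2 ha),
    h.card_toFinset, smul_eq_mul] at h2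
  have h3 := h.total
  have h4 := h.two_le
  obtain ⟨j, rfl⟩ := Nat.exists_eq_add_of_le h4
  have e1 : 2 + j - 1 - 1 = j := by omega
  have e2 : H.card + (2 + j) - 1 = H.card + j + 1 := by omega
  have e3 : 2 + j - 1 = j + 1 := by omega
  rw [e1] at h2
  rw [e2] at h3
  rw [e3]
  nlinarith

/-- A further vertex `r` misses one of the first two vertices of each segment. These sit too early
on their segments to be adjacent to each other, so with `r` and a vertex of `H` they are `K + 2`
independent vertices. -/
theorem IsSaturated.mem_or_mem (h : G.IsSaturated C as S H K o) (r : W) : r ∈ C ∨ r ∈ H := by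
  classical
  by_contra! hr
  obtain ⟨hrC, hrH⟩ := hr
  obtain ⟨p, hp⟩ := h.nonempty
  have hex : ∀ b, ∃ z l₁ l₂, b ∈ as → S b = l₁ ++ z :: l₂ ∧ l₁.length ≤ 1 ∧ ¬ G.Adj r z := by
    intro b
    by_cases hb : b ∈ as
    · have h1 := h.card_le_length hb
      have h2 := h.five_le
      match hSb : S b with
      | [] => rw [hSb, List.length_nil] at h1; omega
      | [u] => rw [hSb] at h1; simp at h1; omega
      | u :: w :: l =>
        by_cases hru : G.Adj r u
        · refine ⟨w, [u], l, fun _ => ⟨rfl, by simp, ?_⟩⟩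
          obtain ⟨l₁, l₂, hl⟩ := h.exists_append hb
          rw [hSb] at hl
          exact h.toIsLongestCycle.not_adj_of_adj (l₂ := l ++ l₂) (by simpa using hl) hrC hru
        · exact ⟨u, [], w :: l, fun _ => ⟨rfl, by simp, hru⟩⟩
    · exact ⟨b, [], [], fun hb' => absurd hb' hb⟩
  choose z l₁ l₂ hz using hex
  have hrp : ¬ G.Adj p r := fun e => hrC (h.mem_of_mem (h.nbr p hp r hrH e))
  have hmem : ∀ b ∈ as, z b ∈ S b := fun b hb => by rw [(hz b hb).1]; simp
  have := h.card_add_card_le (I := as.toFinset) (z := z) (T := {r, p})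
    (fun b hb => List.mem_toFinset.1 hb) (fun b hb => hmem b (List.mem_toFinset.1 hb)) ?_ ?_ ?_
  · rw [h.card_toFinset, Finset.card_pair (by rintro rfl; exact hrH hp)] at this
    omega
  · intro b hb c hc hbc hadj
    rw [List.mem_toFinset] at hb hc
    have h1 := (h.linked.le_of_adj h.toIsSegmented (fun a ha => h.segment_ne_nil ha) hb hc hbc
      (hz b hb).1 (hz c hc).1 hadj).1
    have h2 := (hz b hb).2.1
    have h3 := (hz c hc).2.1
    have h4 := h.five_le
    omega
  · have hrp' : ¬ G.Adj r p := fun e => hrp e.symm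
    simp [hrp, hrp']
  · intro b hb t ht
    rw [List.mem_toFinset] at hb
    rw [Finset.mem_insert, Finset.mem_singleton] at ht
    rcases ht with rfl | rfl
    · refine ⟨?_, fun e => (hz b hb).2.2 e.symm⟩
      rintro rfl
      exact hrC (h.mem_of_mem_segment hb (hmem b hb))
    · exact ⟨h.ne_of_mem_segment hb (hmem b hb) hp,
        fun e => h.not_adj_segment hb (hmem b hb) hp e.symm⟩

/-- Two vertices of a segment are adjacent if the other segments have pairwise nonadjacent
representatives that are not adjacent to either of them. -/
theorem IsSaturated.adj_of_offsets (h : G.IsSaturated C as S H K o) {a : W} (ha : a ∈ as)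
    (z : W → W) (A B : W → List W) (hz : ∀ b ∈ as, b ≠ a → S b = A b ++ z b :: B b)
    (hzz : ∀ b ∈ as, ∀ c ∈ as, b ≠ a → c ≠ a → b ≠ c →
      (A b).length + (A c).length < H.card ∨ (B b).length + (B c).length < H.card)
    {u w : W} {l₁ l₂ t₁ t₂ : List W} (hu : S a = l₁ ++ u :: l₂) (hw : S a = t₁ ++ w :: t₂)
    (huz : ∀ b ∈ as, b ≠ a →
      (A b).length + l₁.length < H.card ∨ (B b).length + l₂.length < H.card)
    (hwz : ∀ b ∈ as, b ≠ a →
      (A b).length + t₁.length < H.card ∨ (B b).length + t₂.length < H.card)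
    (huw : u ≠ w) : G.Adj u w := by
  by_contra hadj
  obtain ⟨p, hp⟩ := h.nonempty
  have hS : ∀ a ∈ as, S a ≠ [] := fun a ha => h.segment_ne_nil ha
  have hmem : ∀ b ∈ as, b ≠ a → z b ∈ S b := fun b hb hba => by rw [hz b hb hba]; simp
  have hua : u ∈ S a := by rw [hu]; simp
  have hwa : w ∈ S a := by rw [hw]; simp
  have hup := h.ne_of_mem_segment ha hua hp
  have hwp := h.ne_of_mem_segment ha hwa hp
  have key : ∀ v ∈ S a, ∀ s₁ s₂, S a = s₁ ++ v :: s₂ → (∀ b ∈ as, b ≠ a →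
      (A b).length + s₁.length < H.card ∨ (B b).length + s₂.length < H.card) →
      ∀ b ∈ as, b ≠ a → z b ≠ v ∧ ¬ G.Adj (z b) v := by
    intro v hv s₁ s₂ hs hlt b hb hba
    refine ⟨?_, ?_⟩
    · rintro rfl
      exact hba (h.eq_of_mem hb ha (hmem b hb hba) hv)
    · intro e
      have h1 := h.linked.le_of_adj h.toIsSegmented hS hb ha hba (hz b hb hba) hs e
      have h2 := hlt b hb hba
      omega
  have := h.card_add_card_le (I := as.toFinset.erase a) (z := z) (T := {u, w, p})
    (fun b hb => List.mem_toFinset.1 (Finset.mem_of_mem_erase hb))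
    (fun b hb => hmem b (List.mem_toFinset.1 (Finset.mem_of_mem_erase hb))
      (Finset.ne_of_mem_erase hb)) ?_ ?_ ?_
  · rw [Finset.card_erase_of_mem (List.mem_toFinset.2 ha), h.card_toFinset,
      Finset.card_insert_of_notMem (by simp [huw, hup]), Finset.card_pair hwp] at this
    have := h.two_le
    omega
  · intro b hb c hc hbc e
    have hba := Finset.ne_of_mem_erase hb
    have hca := Finset.ne_of_mem_erase hc
    have hb' := List.mem_toFinset.1 (Finset.mem_of_mem_erase hb)
    have hc' := List.mem_toFinset.1 (Finset.mem_of_mem_erase hc)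
    have h1 := h.linked.le_of_adj h.toIsSegmented hS hb' hc' hbc (hz b hb' hba) (hz c hc' hca) e
    have h2 := hzz b hb' c hc' hba hca hbc
    omega
  · have h1 : ¬ G.Adj w u := fun e => hadj e.symm
    have h2 := h.not_adj_segment ha hua hp
    have h3 := h.not_adj_segment ha hwa hp
    have h4 : ¬ G.Adj u p := fun e => h2 e.symm
    have h5 : ¬ G.Adj w p := fun e => h3 e.symm
    simp [hadj, h1, h2, h3, h4, h5]
  · intro b hb t ht
    have hba := Finset.ne_of_mem_erase hb
    have hb' := List.mem_toFinset.1 (Finset.mem_of_mem_erase hb)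
    rw [Finset.mem_insert, Finset.mem_insert, Finset.mem_singleton] at ht
    rcases ht with rfl | rfl | rfl
    · exact key _ hua _ _ hu huz b hb' hba
    · exact key _ hwa _ _ hw hwz b hb' hba
    · exact ⟨h.ne_of_mem_segment hb' (hmem b hb' hba) hp,
        fun e => h.not_adj_segment hb' (hmem b hb' hba) hp e.symm⟩

/-- Representatives of the other segments are taken at a common offset adapted to the pair: first
vertices if the pair is near the start, last vertices if it is near the end, and offset `K * (K -
1)` otherwise. -/
theorem IsSaturated.adj_of_mem_segment (h : G.IsSaturated C as S H K o) {a u w : W}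
    (ha : a ∈ as) (hu : u ∈ S a) (hw : w ∈ S a) (huw : u ≠ w) : G.Adj u w := by
  have hrep : ∀ f : W → ℕ, (∀ b ∈ as, f b < (S b).length) → ∃ (A : W → List W) (z : W → W)
      (B : W → List W), ∀ b ∈ as, S b = A b ++ z b :: B b ∧ (A b).length = f b := by
    intro f hf
    have : ∀ b, ∃ A z B, b ∈ as → S b = A ++ z :: B ∧ A.length = f b := by
      intro b
      by_cases hb : b ∈ as
      · obtain ⟨A, z, B, hz⟩ := exists_append_cons_of_lt (hf b hb)
        exact ⟨A, z, B, fun _ => hz⟩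
      · exact ⟨[], b, [], fun h => absurd h hb⟩
    choose A z B hz using this
    exact ⟨A, z, B, hz⟩
  have hH := h.five_le
  -- the order of the two vertices on the segment does not matter
  have main : ∀ (l₁ l₂ l₃ : List W) (u w : W), u ≠ w → S a = l₁ ++ u :: (l₂ ++ w :: l₃) →
      G.Adj u w := by
    intro l₁ l₂ l₃ u w huw hl
    have hl' : S a = (l₁ ++ u :: l₂) ++ w :: l₃ := by simp [hl]
    have hlen := congrArg List.length hl
    simp only [List.length_append, List.length_cons] at hlen
    by_cases h1 : l₁.length + l₂.length + 1 < H.card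
    · obtain ⟨A, z, B, hz⟩ := hrep (fun _ => 0)
        (fun b hb => lt_of_lt_of_le (by omega) (h.card_le_length hb))
      refine h.adj_of_offsets ha z A B (fun b hb _ => (hz b hb).1) ?_ hl hl' ?_ ?_ huw
      · intro b hb c hc _ _ _
        rw [(hz b hb).2, (hz c hc).2]
        omega
      · intro b hb _
        rw [(hz b hb).2]
        omega
      · intro b hb _
        rw [(hz b hb).2]
        simp only [List.length_append, List.length_cons]
        omega
    by_cases h2 : l₂.length + l₃.length + 1 < H.card
    · obtain ⟨A, z, B, hz⟩ := hrep (fun b => (S b).length - 1)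
        (fun b hb => by have := h.card_le_length hb; omega)
      have hB : ∀ b ∈ as, (B b).length = 0 := by
        intro b hb
        have h3 := congrArg List.length (hz b hb).1
        have h4 := (hz b hb).2
        simp only [List.length_append, List.length_cons] at h3
        omega
      refine h.adj_of_offsets ha z A B (fun b hb _ => (hz b hb).1) ?_ hl hl' ?_ ?_ huw
      · intro b hb c hc _ _ _
        rw [hB b hb, hB c hc]
        omega
      · intro b hb _
        rw [hB b hb]
        simp only [List.length_append, List.length_cons]
        omega
      · intro b hb _
        rw [hB b hb]
        omega
    -- Now `u` and `w` are far apart. As the segment exceeds `H.card` by at most `K * (K - 1)`,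
    -- fewer than `K * (K - 1)` vertices precede `u` or follow `w`. Hence `u` is excluded from the
    -- starts and `w` from the ends; the representatives exclude each other because `2 * (K * (K -
    -- 1)) < H.card`.
    · have hlarge := h.large
      obtain ⟨A, z, B, hz⟩ := hrep (fun _ => K * (K - 1))
        (fun b hb => lt_of_lt_of_le (by omega) (h.card_le_length hb))
      have hB : ∀ b ∈ as, (B b).length + K * (K - 1) + 1 = (S b).length := by
        intro b hb
        have h3 := congrArg List.length (hz b hb).1
        have h4 := (hz b hb).2
        simp only [List.length_append, List.length_cons] at h3
        omega
      refine h.adj_of_offsets ha z A B (fun b hb _ => (hz b hb).1) ?_ hl hl' ?_ ?_ huw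
      · intro b hb c hc _ _ _
        rw [(hz b hb).2, (hz c hc).2]
        omega
      · intro b hb hba
        have h3 := h.length_add_length_le ha hb hba.symm
        have h4 := h.card_le_length hb
        rw [(hz b hb).2]
        omega
      · intro b hb hba
        have h3 := h.length_add_length_le ha hb hba.symm
        have h4 := hB b hb
        omega
  obtain ⟨l₁, l₂, hl⟩ := List.append_of_mem hu
  rw [hl, List.mem_append, List.mem_cons] at hw
  rcases hw with hw | rfl | hw
  · obtain ⟨t₁, t₂, rfl⟩ := List.append_of_mem hw
    exact (main t₁ t₂ l₂ w u huw.symm (by simp [hl])).symm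
  · exact absurd rfl huw
  · obtain ⟨t₁, t₂, rfl⟩ := List.append_of_mem hw
    exact main l₁ t₁ t₂ u w huw hl

end Saturated

/-! ### Edges between segments and what they forbid -/

section Chords

variable {W : Type*} {G : SimpleGraph W}

/-- The segment after `c` ends in `y`, the segment after `d` starts with `x'`, the vertices `y`
and `x'` are adjacent, and `m` follows `y` on the cycle. -/
structure IsChord (G : SimpleGraph W) (C as : List W) (S : W → List W) (c d : W)
    (M N : List W) (x y m x' y' n : W) : Prop where
  quad : G.CyclicQuad C (S c) M (S d) N x y m d x' y' n c
  mem₁ : m ∈ as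
  mem₂ : n ∈ as
  passes : ∀ f ∈ as, f ≠ c → f ≠ d → ∃ N₁ N₂ u v c', c' ∈ as ∧
    (G.PassesThrough M (S f) N₁ N₂ m d f u v c' ∨ G.PassesThrough N (S f) N₁ N₂ n c f u v c')
  adj : G.Adj y x'

variable {C as : List W} {S : W → List W} {H : Finset W} {K : ℕ} {o : W}

theorem CyclicQuad.ne_of_mem_of_mem {C S M T N : List W} {x y m m' x' y' n n' : W}
    (h : G.CyclicQuad C S M T N x y m m' x' y' n n') (hC : C.Nodup) {u w : W} (hu : u ∈ M)
    (hw : w ∈ N) : u ≠ w := by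
  rintro rfl
  have := h.nodup hC
  rw [List.append_assoc, List.append_assoc, List.nodup_append] at this
  have := this.2.1
  rw [List.nodup_append] at this
  exact this.2.2 u hu u (List.mem_append_right _ hw) rfl

theorem CyclicQuad.nodup_left {C S M T N : List W} {x y m m' x' y' n n' : W}
    (h : G.CyclicQuad C S M T N x y m m' x' y' n n') (hC : C.Nodup) : M.Nodup := by
  have := h.nodup hC
  rw [List.append_assoc, List.append_assoc, List.nodup_append] at this
  exact this.2.1.of_append_left

variable [DecidableEq W]

theorem IsSaturated.exists_traces (h : G.IsSaturated C as S H K o) {a u w : W}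
    (ha : a ∈ as) (hu : u ∈ S a) (hw : w ∈ S a) (huw : u ≠ w) :
    ∃ l, G.Traces u l w ∧ l.Perm (S a) :=
  exists_traces_of_pairwise (h.segment_nodup ha)
    (fun _ h₁ _ h₂ h₃ => h.adj_of_mem_segment ha h₁ h₂ h₃) hu hw huw

theorem IsSaturated.ne_of_traces (h : G.IsSaturated C as S H K o) {a x y : W} (ha : a ∈ as)
    (ht : G.Traces x (S a) y) : x ≠ y := by
  rintro rfl
  obtain ⟨l, hl⟩ := ht.exists_tail
  have hn := h.segment_nodup ha
  have hlen := h.card_le_length ha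
  have h5 := h.five_le
  rw [hl] at hn hlen
  have hlast := ht.2.2
  rw [hl] at hlast
  cases l with
  | nil => simp at hlen; omega
  | cons z l =>
    rw [List.getLast?_cons_cons] at hlast
    exact (List.nodup_cons.1 hn).1 (List.mem_of_mem_getLast? hlast)

/-- Edges between two segments join the end of one to the start of the other. -/
theorem IsSaturated.exists_isChord (h : G.IsSaturated C as S H K o) {a b u w : W} (ha : a ∈ as)
    (hb : b ∈ as) (hab : a ≠ b) (hu : u ∈ S a) (hw : w ∈ S b) (huw : G.Adj u w) :
    (∃ M N x m y' n, G.IsChord C as S a b M N x u m w y' n) ∨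
      ∃ M N x m y' n, G.IsChord C as S b a M N x w m u y' n := by
  obtain ⟨M, N, x, y, m, x', y', n, hQ, hm, hn, hpass⟩ :=
    h.exists_quad (fun a ha => h.segment_ne_nil ha) ha hb hab
  -- Otherwise the cliques `S a` and `S b` can be traversed from `y` to `u` and from `w` to `y'`,
  -- and the edge `uw` yields a longer cycle. `h2` is the same on the reversed cycle.
  have h1 : u = y ∨ w = y' := by
    by_contra! hne
    obtain ⟨S', tS, hS⟩ := h.exists_traces ha hQ.trS.last_mem hu hne.1.symm
    obtain ⟨T', tT, hT⟩ := h.exists_traces hb hw hQ.trT.last_mem hne.2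
    obtain ⟨hl, p, q, hnd, hoff, ht, e₁, e₂, -⟩ := h.linked a ha b hb hab
    exact hQ.not_adj_of_perm h.toIsLongestCycle hnd hoff ht e₁ e₂ hS hT tS tT huw
  have h2 : u = x ∨ w = x' := by
    by_contra! hne
    obtain ⟨S', tS, hS⟩ := h.exists_traces ha hQ.trS.head_mem hu hne.1.symm
    obtain ⟨T', tT, hT⟩ := h.exists_traces hb hw hQ.trT.head_mem hne.2
    obtain ⟨hl, p, q, hnd, hoff, ht, e₁, e₂, -⟩ := h.linked m hm n hn
      (hQ.ne_of_mem_of_mem h.nodup hQ.trM.head_mem hQ.trN.head_mem)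
    exact hQ.rev.not_adj_of_perm h.toIsLongestCycle hnd hoff ht e₁ e₂
      (hS.trans (List.reverse_perm _).symm) (hT.trans (List.reverse_perm _).symm) tS tT huw
  have hxy := h.ne_of_traces ha hQ.trS
  have hxy' := h.ne_of_traces hb hQ.trT
  rcases h1 with rfl | rfl
  · rcases h2 with rfl | rfl
    · exact absurd rfl hxy
    · exact .inl ⟨M, N, x, m, y', n, hQ, hm, hn, hpass, huw⟩
  · rcases h2 with rfl | rfl
    · refine .inr ⟨N, M, x', n, y, m, hQ.rot, hn, hm, ?_, huw.symm⟩
      intro f hf hfb hfa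
      obtain ⟨N₁, N₂, u, v, c', hc', hp⟩ := hpass f hf hfa hfb
      exact ⟨N₁, N₂, u, v, c', hc', hp.symm⟩
    · exact absurd rfl hxy'

variable {c d x y m x' y' n : W} {M N : List W}

/-- `S c` can be run from `z` to `y`, where the chord leads on to `S d`. The walk `M`, thus freed,
fits between the detour and `z` in either direction, so neither of its ends may see `z`. -/
theorem IsSaturated.not_adj_of_isChord (h : G.IsSaturated C as S H K o)
    (hX : G.IsChord C as S c d M N x y m x' y' n) (hc : c ∈ as) (hd : d ∈ as) (hcd : c ≠ d)
    {z : W} (hz : z ∈ S c) (hzy : z ≠ y) : ¬ G.Adj m z ∧ ¬ G.Adj d z := by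
  obtain ⟨S', tS, hS⟩ := h.exists_traces hc hz hX.quad.trS.last_mem hzy
  have hmc : m ≠ c := hX.quad.ne_of_mem_of_mem h.nodup hX.quad.trM.head_mem hX.quad.trN.last_mem
  constructor
  · obtain ⟨hl, p, q, hnd, hoff, ht, e₁, e₂, -⟩ := h.linked c hc d hd hcd
    exact hX.quad.not_adj_of_chord h.toIsLongestCycle hnd hoff ht hX.adj
      (List.reverse_perm M) hX.quad.trM.reverse hS tS e₁ e₂
  · obtain ⟨hl, p, q, hnd, hoff, ht, e₁, e₂, -⟩ := h.linked c hc m hX.mem₁ hmc.symm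
    exact hX.quad.not_adj_of_chord h.toIsLongestCycle hnd hoff ht hX.adj
      (List.Perm.refl M) hX.quad.trM hS tS e₁ e₂

/-- The universal vertex sees the first vertex of `S c`, which `m` and `d` do not. -/
theorem IsSaturated.ne_of_isChord (h : G.IsSaturated C as S H K o)
    (hX : G.IsChord C as S c d M N x y m x' y' n) (hc : c ∈ as) (hd : d ∈ as) (hcd : c ≠ d) :
    m ≠ o ∧ d ≠ o := by
  have hx := hX.quad.trS.head_mem
  have hxo : x ≠ o := by
    rintro rfl
    exact h.not_mem_segment h.mem_as hc hx
  have := h.not_adj_of_isChord hX hc hd hcd hx (h.ne_of_traces hc hX.quad.trS)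
  constructor
  · rintro rfl
    exact this.1 (h.adj_univ x hxo)
  · rintro rfl
    exact this.2 (h.adj_univ x hxo)

/-- The chord bypasses `M`, which can be inserted with a detour next to any segment on the other
side. -/
theorem IsSaturated.not_adj_of_isChord_of_passesThrough (h : G.IsSaturated C as S H K o)
    (hX : G.IsChord C as S c d M N x y m x' y' n) (hd : d ∈ as)
    {f u v c' : W} {N₁ N₂ : List W} (hf : f ∈ as) (hc' : c' ∈ as)
    (hP : G.PassesThrough N (S f) N₁ N₂ n c f u v c') {z : W} (hz : z ∈ S f) :
    ¬ G.Adj m z ∧ ¬ G.Adj d z := by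
  have hfN : f ∈ N := by rw [hP.eq]; simp [hP.tr₁.last_mem]
  have hcN : c' ∈ N := by rw [hP.eq]; simp [hP.tr₂.head_mem]
  have hmM := hX.quad.trM.head_mem
  have hdM := hX.quad.trM.last_mem
  have hne : ∀ s ∈ M, ∀ t ∈ N, t ≠ s := fun s hs t ht =>
    (hX.quad.ne_of_mem_of_mem h.nodup hs ht).symm
  -- both directions along the walk, and both directions along the segment
  have key : ∀ s t M', M'.Perm M → G.Traces s M' t → s ∈ as → s ∈ M → ¬ G.Adj t z := by
    intro s t M' hM tM hs hsM
    by_cases hzv : z = v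
    · have hzu : z ≠ u := by
        rintro rfl
        exact h.ne_of_traces hf hP.tr hzv
      obtain ⟨U', tU, hU⟩ := h.exists_traces hf hz hP.tr.head_mem hzu
      obtain ⟨hl, p, q, hnd, hoff, ht, e₁, e₂, -⟩ := h.linked c' hc' s hs (hne s hsM c' hcN)
      exact hX.quad.rev.rot.not_adj_of_chord_of_passesThrough h.toIsLongestCycle hnd hoff ht
        hX.adj.symm hP.rev (hM.trans (List.reverse_perm _).symm) tM
        (hU.trans (List.reverse_perm _).symm) tU e₁ e₂
    · obtain ⟨U', tU, hU⟩ := h.exists_traces hf hz hP.tr.last_mem hzv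
      obtain ⟨hl, p, q, hnd, hoff, ht, e₁, e₂, -⟩ := h.linked f hf s hs (hne s hsM f hfN)
      exact hX.quad.not_adj_of_chord_of_passesThrough h.toIsLongestCycle hnd hoff ht
        hX.adj hP hM tM hU tU e₁ e₂
  exact ⟨key d m _ (List.reverse_perm M) hX.quad.trM.reverse hd hdM,
    key m d _ (List.Perm.refl M) hX.quad.trM hX.mem₁ hmM⟩

theorem IsSaturated.nbr_segment (h : G.IsSaturated C as S H K o) {a u w : W} (ha : a ∈ as)
    (hu : u ∈ S a) (hw : w ∉ S a) (hadj : G.Adj u w) :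
    w ∈ as ∨ ∃ b ∈ as, b ≠ a ∧ w ∈ S b := by
  rcases h.mem_or_mem w with hC | hH
  · rcases h.mem_iff.1 hC with h1 | ⟨b, hb, hwb⟩
    · exact .inl h1
    · refine .inr ⟨b, hb, ?_, hwb⟩
      rintro rfl
      exact hw hwb
  · exact absurd hadj.symm (h.not_adj_segment ha hu hH)

/-- A segment without chords is joined to all cutting vertices, by disjoint edges for any two. -/
theorem IsSaturated.exists_distinct_nbrs_segment (h : G.IsSaturated C as S H K o) {f : W}
    (hf : f ∈ as) (hno : ∀ u ∈ S f, ∀ b ∈ as, b ≠ f → ∀ w ∈ S b, ¬ G.Adj u w) {a b : W}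
    (ha : a ∈ as) (hb : b ∈ as) (hab : a ≠ b) :
    ∃ p ∈ S f, ∃ q ∈ S f, p ≠ q ∧ G.Adj a p ∧ G.Adj b q := by
  obtain ⟨r, hr⟩ := h.nonempty
  obtain ⟨p, hp, q, hq, H'⟩ := h.exists_distinct_nbrs (X := (S f).toFinset) (B := as.toFinset)
    h.card_toFinset (by
      rw [List.toFinset_card_of_nodup (h.segment_nodup hf)]
      have := h.card_le_length hf
      have := h.five_le
      omega)
    (by
      intro z hz hz'
      exact h.not_mem_segment (List.mem_toFinset.1 hz') hf (List.mem_toFinset.1 hz))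
    (by
      intro u hu w hw hadj
      rw [List.mem_toFinset] at hu hw ⊢
      rcases h.nbr_segment hf hu hw hadj with h1 | ⟨b, hb, hba, hwb⟩
      · exact h1
      · exact absurd hadj (hno u hu b hb hba w hwb))
    ⟨r, by
      rw [List.mem_toFinset]
      exact fun h' => h.off r hr (h.mem_of_mem_segment hf h'), by
      rw [List.mem_toFinset]
      exact fun h' => h.off r hr (h.mem_of_mem h')⟩
    (List.mem_toFinset.2 ha) (List.mem_toFinset.2 hb) hab
  exact ⟨p, List.mem_toFinset.1 hp, q, List.mem_toFinset.1 hq, H'⟩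

/-- If there is a chord at the segment of the universal vertex, then `m = d`, and any two cutting
vertices have distinct neighbours in this segment. -/
theorem IsSaturated.of_isChord_univ (h : G.IsSaturated C as S H K o)
    (hX : G.IsChord C as S o d M N x y m x' y' n) (hd : d ∈ as) (hod : o ≠ d)
    (huniq : ∀ u ∈ S o, ∀ b ∈ as, b ≠ o → ∀ w ∈ S b, G.Adj u w → u = y) :
    m = d ∧ ∀ a ∈ as, ∀ b ∈ as, a ≠ b → ∃ p ∈ S o, ∃ q ∈ S o, p ≠ q ∧ G.Adj a p ∧ G.Adj b q := by
  have ho := h.mem_as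
  have hy : y ∈ S o := hX.quad.trS.last_mem
  obtain ⟨r, hr⟩ := h.nonempty
  have hyas : y ∉ as := fun h' => h.not_mem_segment h' ho hy
  -- In `S o`, only `y` can see `d` and only `y` has neighbours in other segments. So `y` may
  -- replace `d` in the separator, which cuts off the rest of `S o`.
  have key : ∀ a ∈ insert y (as.toFinset.erase d), ∀ b ∈ insert y (as.toFinset.erase d), a ≠ b →
      ∃ p ∈ (S o).toFinset.erase y, ∃ q ∈ (S o).toFinset.erase y, p ≠ q ∧ G.Adj a p ∧
        G.Adj b q := by
    intro a ha b hb hab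
    refine h.exists_distinct_nbrs ?_ ?_ ?_ ?_ ⟨r, ?_, ?_⟩ ha hb hab
    · rw [Finset.card_insert_of_notMem, Finset.card_erase_of_mem (List.mem_toFinset.2 hd),
        h.card_toFinset]
      · have := h.two_le; omega
      · intro h'
        exact hyas (List.mem_toFinset.1 (Finset.mem_of_mem_erase h'))
    · rw [Finset.card_erase_of_mem (List.mem_toFinset.2 hy),
        List.toFinset_card_of_nodup (h.segment_nodup ho)]
      have := h.card_le_length ho
      have := h.five_le
      omega
    · intro z hz hz'
      rw [Finset.mem_erase, List.mem_toFinset] at hz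
      rw [Finset.mem_insert, Finset.mem_erase, List.mem_toFinset] at hz'
      rcases hz' with hz' | hz'
      · exact hz.1 hz'
      · exact h.not_mem_segment hz'.2 ho hz.2
    · intro u hu w hw hadj
      rw [Finset.mem_erase, List.mem_toFinset] at hu hw
      rw [Finset.mem_insert, Finset.mem_erase, List.mem_toFinset]
      by_cases hwy : w = y
      · exact .inl hwy
      · have hwS : w ∉ S o := fun h' => hw ⟨hwy, h'⟩
        rcases h.nbr_segment ho hu.2 hwS hadj with h1 | ⟨b, hb, hba, hwb⟩
        · refine .inr ⟨?_, h1⟩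
          rintro rfl
          exact (h.not_adj_of_isChord hX ho hd hod hu.2 hu.1).2 hadj.symm
        · exact absurd (huniq u hu.2 b hb hba w hwb hadj) hu.1
    · rw [Finset.mem_erase, List.mem_toFinset]
      exact fun h' => h.off r hr (h.mem_of_mem_segment ho h'.2)
    · rw [Finset.mem_insert, Finset.mem_erase, List.mem_toFinset]
      rintro (h' | h')
      · rw [h'] at hr
        exact h.off y hr (h.mem_of_mem_segment ho hy)
      · exact h.off r hr (h.mem_of_mem h'.2)
  have hB : ∀ a ∈ as, a ≠ d → a ∈ insert y (as.toFinset.erase d) := by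
    intro a ha had
    simp [ha, had]
  have hyB : y ∈ insert y (as.toFinset.erase d) := by simp
  -- Otherwise `m` stays in the separator and sees a vertex of `S o` other than `y`, which the chord
  -- forbids.
  have hmd : m = d := by
    by_contra hmd
    obtain ⟨p, hp, -, -, -, e, -⟩ := key m (hB m hX.mem₁ hmd) y hyB (by
      rintro rfl
      exact hyas hX.mem₁)
    rw [Finset.mem_erase, List.mem_toFinset] at hp
    exact (h.not_adj_of_isChord hX ho hd hod hp.2 hp.1).1 e
  have hdy : G.Adj d y := by
    rw [← hmd]
    exact hX.quad.adjSM.symm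
  have hsub : ∀ p ∈ (S o).toFinset.erase y, p ∈ S o ∧ p ≠ y := by
    intro p hp
    rw [Finset.mem_erase, List.mem_toFinset] at hp
    exact hp.symm
  refine ⟨hmd, ?_⟩
  intro a ha b hb hab
  by_cases had : a = d
  · subst had
    obtain ⟨q, hq, -, -, -, e, -⟩ := key b (hB b hb hab.symm) y hyB (by
      rintro rfl
      exact hyas hb)
    exact ⟨y, hy, q, (hsub q hq).1, (hsub q hq).2.symm, hdy, e⟩
  by_cases hbd : b = d
  · subst hbd
    obtain ⟨q, hq, -, -, -, e, -⟩ := key a (hB a ha hab) y hyB (by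
      rintro rfl
      exact hyas ha)
    exact ⟨q, (hsub q hq).1, y, hy, (hsub q hq).2, e, hdy⟩
  · obtain ⟨p, hp, q, hq, hpq, e₁, e₂⟩ := key a (hB a ha had) b (hB b hb hbd) hab
    exact ⟨p, (hsub p hp).1, q, (hsub q hq).1, hpq, e₁, e₂⟩

end Chords

/-! ### Exclusion of chords and the final degree count -/

section NoChords

variable {W : Type*} {G : SimpleGraph W} [DecidableEq W]
variable {C as : List W} {S : W → List W} {H : Finset W} {K : ℕ} {o : W}
  {c d x y m x' y' n : W} {M N : List W}

/-- A chord into the start of `S o` is impossible by `IsSaturated.ne_of_isChord`, so every edge from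
`S o` to another segment leaves from its last vertex. -/
theorem IsSaturated.eq_of_isChord_univ (h : G.IsSaturated C as S H K o)
    (hX : G.IsChord C as S o d M N x y m x' y' n) {u b w : W} (hu : u ∈ S o) (hb : b ∈ as)
    (hbo : b ≠ o) (hw : w ∈ S b) (hadj : G.Adj u w) : u = y := by
  rcases h.exists_isChord h.mem_as hb hbo.symm hu hw hadj with
    ⟨_, _, _, _, _, _, hY⟩ | ⟨_, _, _, _, _, _, hY⟩
  · exact Option.some_injective _ (hY.quad.trS.2.2.symm.trans hX.quad.trS.2.2)
  · exact absurd rfl (h.ne_of_isChord hY hb h.mem_as hbo).2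

theorem IsSaturated.exists_distinct_nbrs_univ (h : G.IsSaturated C as S H K o) {a b : W}
    (ha : a ∈ as) (hb : b ∈ as) (hab : a ≠ b) :
    ∃ p ∈ S o, ∃ q ∈ S o, p ≠ q ∧ G.Adj a p ∧ G.Adj b q := by
  by_cases hno : ∀ u ∈ S o, ∀ b ∈ as, b ≠ o → ∀ w ∈ S b, ¬ G.Adj u w
  · exact h.exists_distinct_nbrs_segment h.mem_as hno ha hb hab
  · push Not at hno
    obtain ⟨u, hu, d, hd, hdo, w, hw, hadj⟩ := hno
    rcases h.exists_isChord h.mem_as hd hdo.symm hu hw hadj with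
      ⟨_, _, _, _, _, _, hX⟩ | ⟨_, _, _, _, _, _, hX⟩
    · exact (h.of_isChord_univ hX hd hdo.symm
        (fun _ hu _ hb hbo _ hw hadj => h.eq_of_isChord_univ hX hu hb hbo hw hadj)).2 a ha b hb hab
    · exact absurd rfl (h.ne_of_isChord hX hd h.mem_as hdo).2

/-- Otherwise `S o` lies inside `M` or `N`. In `M`, the rerouting that opens `M` at `S o` closes
through the edge from `y'` to `o`. In `N`, the chord forbids `d` a neighbour in `S o`, yet it has
one. -/
theorem IsSaturated.eq_univ_of_isChord (h : G.IsSaturated C as S H K o)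
    (hX : G.IsChord C as S c d M N x y m x' y' n) (hc : c ∈ as) (hd : d ∈ as) (hcd : c ≠ d) :
    c = o := by
  by_contra hco
  have ho := h.mem_as
  obtain ⟨hmo, hdo⟩ := h.ne_of_isChord hX hc hd hcd
  obtain ⟨N₁, N₂, u, v, c', hc', hP | hP⟩ := hX.passes o ho (Ne.symm hco) hdo.symm
  · have hc'n : c' ≠ n := hX.quad.ne_of_mem_of_mem h.nodup
      (by rw [hP.eq]; simp [hP.tr₂.head_mem]) hX.quad.trN.head_mem
    have hmd : m ≠ d := by
      rintro rfl
      have := hX.quad.nodup_left h.nodup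
      rw [hP.eq, List.nodup_append] at this
      exact this.2.2 m (List.mem_append_left _ hP.tr₁.head_mem) m hP.tr₂.last_mem rfl
    obtain ⟨z₁, hz₁, z₂, hz₂, hz, e₃, e₄⟩ := h.exists_distinct_nbrs_univ hc' hX.mem₂ hc'n
    obtain ⟨U', tU, hU⟩ := h.exists_traces ho hz₁ hz₂ hz
    obtain ⟨hl, p, q, hnd, hoff, ht, e₁, e₂, -⟩ := h.linked m hX.mem₁ d hd hmd
    have hy'o : y' ≠ o := by
      rintro rfl
      exact h.not_mem_segment ho hd hX.quad.trT.last_mem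
    exact hX.quad.not_adj_of_passesThrough h.toIsLongestCycle hnd hoff ht hP hU tU e₁ e₂ e₃
      e₄.symm (h.adj_univ y' hy'o).symm hX.adj
  · obtain ⟨z, hz, -, -, -, e, -⟩ := h.exists_distinct_nbrs_univ hd hc hcd.symm
    exact (h.not_adj_of_isChord_of_passesThrough hX hd ho hc' hP hz).2 e

/-- Vertices of different segments are not adjacent. -/
theorem IsSaturated.not_adj (h : G.IsSaturated C as S H K o) {a b u w : W} (ha : a ∈ as)
    (hb : b ∈ as) (hab : a ≠ b) (hu : u ∈ S a) (hw : w ∈ S b) : ¬ G.Adj u w := by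
  have ho := h.mem_as
  have main : ∀ d ∈ as, d ≠ o → ∀ M N x y m x' y' n, ¬ G.IsChord C as S o d M N x y m x' y' n := by
    intro d hd hdo M N x y m x' y' n hX
    have hmd := (h.of_isChord_univ hX hd hdo.symm
        (fun _ hu _ hb hbo _ hw hadj => h.eq_of_isChord_univ hX hu hb hbo hw hadj)).1
    subst hmd
    have hy : y ∈ S o := hX.quad.trS.last_mem
    have hx' := hX.quad.trT.head_mem
    -- For `K ≥ 3`, a third segment `S f` has no chords: one from `S o` into it would let both `f`
    -- and `m` see only `y` in `S o`. So `m` has a neighbour in `S f`, which lies on `N` because `M`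
    -- is the single vertex `m`; the chord forbids this. For `K = 2`, the vertex `y` sees the rest
    -- of `S o` and `m`, `x'`, `o`, too many.
    by_cases hK : 3 ≤ K
    · obtain ⟨f, hf⟩ : ((as.toFinset.erase o).erase m).Nonempty := by
        rw [← Finset.card_pos, Finset.card_erase_of_mem (Finset.mem_erase.2
          ⟨hdo, List.mem_toFinset.2 hd⟩), Finset.card_erase_of_mem (List.mem_toFinset.2 ho),
          h.card_toFinset]
        omega
      rw [Finset.mem_erase, Finset.mem_erase, List.mem_toFinset] at hf
      obtain ⟨hfd, hfo, hf⟩ := hf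
      have hno : ∀ u ∈ S f, ∀ b ∈ as, b ≠ f → ∀ w ∈ S b, ¬ G.Adj u w := by
        intro u hu b hb hbf w hw hadj
        rcases h.exists_isChord hf hb hbf.symm hu hw hadj with
          ⟨_, _, _, _, _, _, hY⟩ | ⟨M₂, _, _, _, _, _, hY⟩
        · exact hfo (h.eq_univ_of_isChord hY hf hb hbf.symm)
        · have hbo := h.eq_univ_of_isChord hY hb hf hbf
          subst hbo
          have := (h.of_isChord_univ hY hf hbf
            (fun _ hu _ hb hbo _ hw hadj => h.eq_of_isChord_univ hY hu hb hbo hw hadj)).1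
          subst this
          have hwy : w = y := h.eq_of_isChord_univ hX hw hf hfo hu hadj.symm
          subst hwy
          obtain ⟨p, hp, q, hq, hpq, e₁, e₂⟩ := h.exists_distinct_nbrs_univ hf hd hfd
          -- both cutting vertices see only the last vertex of the segment
          have h1 : p = w := by
            by_contra hne
            exact (h.not_adj_of_isChord hY ho hf hbf hp hne).2 e₁
          have h2 : q = w := by
            by_contra hne
            exact (h.not_adj_of_isChord hX ho hd hdo.symm hq hne).2 e₂
          exact hpq (h1.trans h2.symm)
      obtain ⟨z, hz, -, -, -, e, -⟩ :=
        h.exists_distinct_nbrs_segment hf hno hd ho hdo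
      obtain ⟨N₁, N₂, u, v, c', hc', hP | hP⟩ := hX.passes f hf hfo hfd
      · have := hX.quad.nodup_left h.nodup
        rw [hP.eq, List.nodup_append] at this
        exact this.2.2 m (List.mem_append_left _ hP.tr₁.head_mem) m hP.tr₂.last_mem rfl
      · exact (h.not_adj_of_isChord_of_passesThrough hX hd hf hc' hP hz).2 e
    · have hyo : y ≠ o := by
        rintro rfl
        exact h.not_mem_segment ho ho hy
      have hlt := h.deg y hyo ((S o).toFinset.erase y ∪ {m, x', o}) (by
        intro u hu
        rw [Finset.mem_union, Finset.mem_erase, List.mem_toFinset] at hu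
        rcases hu with hu | hu
        · exact h.adj_of_mem_segment ho hy hu.2 hu.1.symm
        · rw [Finset.mem_insert, Finset.mem_insert, Finset.mem_singleton] at hu
          rcases hu with rfl | rfl | rfl
          · exact hX.quad.adjSM
          · exact hX.adj
          · exact (h.adj_univ y hyo).symm)
      have hmx : m ≠ x' := by
        rintro rfl
        exact h.not_mem_segment hd hd hx'
      have hxo : x' ≠ o := by
        rintro rfl
        exact h.not_mem_segment ho hd hx'
      have hcard3 : ({m, x', o} : Finset W).card = 3 := by
        rw [Finset.card_insert_of_notMem (by simp [hmx, hdo]), Finset.card_pair hxo]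
      rw [Finset.card_union_of_disjoint, hcard3, Finset.card_erase_of_mem (List.mem_toFinset.2 hy),
        List.toFinset_card_of_nodup (h.segment_nodup ho)] at hlt
      · have := h.card_le_length ho
        have := h.five_le
        omega
      · rw [Finset.disjoint_left]
        intro u hu hu'
        have hu := List.mem_toFinset.1 (Finset.mem_of_mem_erase hu)
        rw [Finset.mem_insert, Finset.mem_insert, Finset.mem_singleton] at hu'
        rcases hu' with rfl | rfl | rfl
        · exact h.not_mem_segment hd ho hu
        · exact hdo (h.eq_of_mem hd ho hx' hu)
        · exact h.not_mem_segment ho ho hu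
  intro hadj
  rcases h.exists_isChord ha hb hab hu hw hadj with
    ⟨_, _, _, _, _, _, hX⟩ | ⟨_, _, _, _, _, _, hX⟩
  · have := h.eq_univ_of_isChord hX ha hb hab
    subst this
    exact main b hb hab.symm _ _ _ _ _ _ _ _ hX
  · have := h.eq_univ_of_isChord hX hb ha hab.symm
    subst this
    exact main a ha hab _ _ _ _ _ _ _ _ hX

/-- Some cutting vertex has too many neighbours. -/
theorem IsSaturated.false (h : G.IsSaturated C as S H K o) : False := by
  have ho := h.mem_as
  obtain ⟨a, ha⟩ : (as.toFinset.erase o).Nonempty := by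
    rw [← Finset.card_pos, Finset.card_erase_of_mem (List.mem_toFinset.2 ho), h.card_toFinset]
    have := h.two_le
    omega
  rw [Finset.mem_erase, List.mem_toFinset] at ha
  obtain ⟨hao, ha⟩ := ha
  have hnb : ∀ b, ∃ q, b ∈ as → q ∈ S b ∧ G.Adj a q := by
    intro b
    by_cases hb : b ∈ as
    · obtain ⟨q, hq, -, -, -, e, -⟩ := h.exists_distinct_nbrs_segment hb
        (fun u hu d hd hdb w hw => h.not_adj hb hd hdb.symm hu hw) ha ho hao
      exact ⟨q, fun _ => ⟨hq, e⟩⟩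
    · exact ⟨b, fun h => absurd h hb⟩
  choose q hq using hnb
  have hinj : Set.InjOn q as.toFinset := by
    intro b hb c hc hbc
    have hb := List.mem_toFinset.1 hb
    have hc := List.mem_toFinset.1 hc
    exact h.eq_of_mem hb hc (hq b hb).1 (hbc ▸ (hq c hc).1)
  obtain ⟨p, hp, hap⟩ := h.att a ha
  -- The cliques are `H` and the `K` segments, and `a` has a neighbour in each. If `a` is complete
  -- to one, a neighbour in each of the other `K` brings its degree to at least `H.card + K`.
  by_cases hH : ∀ r ∈ H, G.Adj a r
  · have hlt := h.deg a hao (H ∪ as.toFinset.image q) (by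
      intro u hu
      rw [Finset.mem_union, Finset.mem_image] at hu
      rcases hu with hu | ⟨b, hb, rfl⟩
      · exact hH u hu
      · exact (hq b (List.mem_toFinset.1 hb)).2)
    rw [Finset.card_union_of_disjoint, Finset.card_image_of_injOn hinj, h.card_toFinset] at hlt
    · omega
    · rw [Finset.disjoint_left]
      intro u hu hu'
      obtain ⟨b, hb, rfl⟩ := Finset.mem_image.1 hu'
      have hb := List.mem_toFinset.1 hb
      exact h.off _ hu (h.mem_of_mem_segment hb (hq b hb).1)
  push Not at hH
  obtain ⟨r, hr, har⟩ := hH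
  by_cases hS : ∃ b ∈ as, ∀ z ∈ S b, G.Adj a z
  · obtain ⟨b, hb, hbS⟩ := hS
    have hlt := h.deg a hao (((S b).toFinset ∪ (as.toFinset.erase b).image q) ∪ {p}) (by
      intro u hu
      rw [Finset.mem_union, Finset.mem_union, Finset.mem_image, List.mem_toFinset,
        Finset.mem_singleton] at hu
      rcases hu with (hu | ⟨b, hb, rfl⟩) | rfl
      · exact hbS u hu
      · exact (hq b (List.mem_toFinset.1 (Finset.mem_of_mem_erase hb))).2
      · exact hap)
    rw [Finset.card_union_of_disjoint, Finset.card_union_of_disjoint,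
      Finset.card_image_of_injOn (hinj.mono (Finset.coe_subset.2 (Finset.erase_subset _ _))),
      Finset.card_erase_of_mem (List.mem_toFinset.2 hb),
      h.card_toFinset, Finset.card_singleton,
      List.toFinset_card_of_nodup (h.segment_nodup hb)] at hlt
    · have := h.card_le_length hb
      have := h.two_le
      omega
    · rw [Finset.disjoint_left]
      intro u hu hu'
      obtain ⟨c, hc, rfl⟩ := Finset.mem_image.1 hu'
      have hc' := List.mem_toFinset.1 (Finset.mem_of_mem_erase hc)
      exact Finset.ne_of_mem_erase hc
        (h.eq_of_mem hc' hb (hq c hc').1 (List.mem_toFinset.1 hu))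
    · rw [Finset.disjoint_singleton_right, Finset.mem_union, Finset.mem_image, List.mem_toFinset]
      rintro (hpS | ⟨c, hc, rfl⟩)
      · exact h.off p hp (h.mem_of_mem_segment hb hpS)
      · have hc' := List.mem_toFinset.1 (Finset.mem_of_mem_erase hc)
        exact h.off _ hp (h.mem_of_mem_segment hc' (hq c hc').1)
  push Not at hS
  have hz : ∀ b, ∃ z, b ∈ as → z ∈ S b ∧ ¬ G.Adj a z := by
    intro b
    by_cases hb : b ∈ as
    · obtain ⟨z, hz⟩ := hS b hb
      exact ⟨z, fun _ => hz⟩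
    · exact ⟨b, fun h => absurd h hb⟩
  choose z hz using hz
  have hra : ¬ G.Adj r a := fun e => har e.symm
  have := h.card_add_card_le (I := as.toFinset) (z := z) (T := {a, r})
    (fun b hb => List.mem_toFinset.1 hb) (fun b hb => (hz b (List.mem_toFinset.1 hb)).1)
    (fun b hb c hc hbc => h.not_adj (List.mem_toFinset.1 hb) (List.mem_toFinset.1 hc) hbc
      (hz b (List.mem_toFinset.1 hb)).1 (hz c (List.mem_toFinset.1 hc)).1)
    (by simp [har, hra]) (by
      intro b hb t ht
      have hb := List.mem_toFinset.1 hb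
      rw [Finset.mem_insert, Finset.mem_singleton] at ht
      rcases ht with rfl | rfl
      · refine ⟨?_, fun e => (hz b hb).2 e.symm⟩
        rintro h'
        exact h.not_mem_segment ha hb (h' ▸ (hz b hb).1)
      · exact ⟨h.ne_of_mem_segment hb (hz b hb).1 hr,
          fun e => h.not_adj_segment hb (hz b hb).1 hr e.symm⟩)
  rw [h.card_toFinset, Finset.card_pair (by
    rintro rfl
    exact h.off a hr (h.mem_of_mem ha))] at this
  omega

end NoChords

/-! ### Adding a universal vertex -/

section Cone

variable {V : Type*}

/-- The graph `G` with an additional vertex `none` that is adjacent to all vertices of `G`. -/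
def cone (G : SimpleGraph V) : SimpleGraph (Option V) where
  Adj x y := (∃ u v, x = some u ∧ y = some v ∧ G.Adj u v) ∨ (x = none ∧ y ≠ none) ∨
    (x ≠ none ∧ y = none)
  symm := ⟨by
    rintro x y (⟨u, v, rfl, rfl, e⟩ | ⟨hx, hy⟩ | ⟨hx, hy⟩)
    · exact .inl ⟨v, u, rfl, rfl, e.symm⟩
    · exact .inr (.inr ⟨hy, hx⟩)
    · exact .inr (.inl ⟨hy, hx⟩)⟩
  loopless := ⟨by
    rintro x (⟨u, v, rfl, h, e⟩ | ⟨hx, hy⟩ | ⟨hx, hy⟩)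
    · exact e.ne (Option.some_injective _ h)
    · exact hy hx
    · exact hx hy⟩

variable {G : SimpleGraph V}

@[simp] theorem cone_adj_some_some {u v : V} : G.cone.Adj (some u) (some v) ↔ G.Adj u v := by
  simp [cone]

@[simp] theorem cone_adj_none_some {v : V} : G.cone.Adj none (some v) := by
  simp [cone]

theorem cone_adj_none {w : Option V} (hw : w ≠ none) : G.cone.Adj none w :=
  .inr (.inl ⟨rfl, hw⟩)

theorem isChain_cone_map_some {l : List V} :
    (l.map some).IsChain G.cone.Adj ↔ l.IsChain G.Adj := by
  rw [List.isChain_map]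
  simp

theorem exists_eq_map_some {l : List (Option V)} (hl : none ∉ l) : ∃ l' : List V,
    l = l'.map some := by
  induction l with
  | nil => exact ⟨[], rfl⟩
  | cons x l ih =>
    obtain ⟨l', rfl⟩ := ih (fun h => hl (List.mem_cons_of_mem _ h))
    cases x with
    | none => exact absurd List.mem_cons_self hl
    | some x => exact ⟨x :: l', rfl⟩

/-- A longest path of `G` becomes a longest cycle of the cone. -/
theorem isLongestCycle_cone {P : List V} (hne : P ≠ []) (hc : P.IsChain G.Adj) (hn : P.Nodup)
    (hmax : ∀ Q : List V, Q.IsChain G.Adj → Q.Nodup → Q.length ≤ P.length) :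
    G.cone.IsLongestCycle (none :: P.map some) where
  cyc := by
    have h : G.cone.Traces (some (P.head hne)) (P.map some) (some (P.getLast hne)) :=
      ⟨isChain_cone_map_some.2 hc, by simp [List.head?_eq_some_head hne],
        by simp [List.getLast?_eq_some_getLast hne]⟩
    exact ⟨_, _, (Traces.single none).append (by simp) h, (by simp : G.cone.Adj _ _).symm⟩
  nodup := by simp [hn.map (Option.some_injective V)]
  max := by
    intro l hl hln
    have hchain : l.IsChain G.cone.Adj := by
      obtain ⟨u, v, h, -⟩ := hl
      exact h.1
    by_cases hnone : none ∈ l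
    · obtain ⟨l₁, l₂, rfl⟩ := List.append_of_mem hnone
      obtain ⟨u, v, h, -⟩ := hl.rotate
      have hperm : (l₁ ++ none :: l₂).Perm (none :: (l₂ ++ l₁)) := List.perm_append_comm
      have hn' := hperm.nodup_iff.1 hln
      rw [List.nodup_cons] at hn'
      obtain ⟨Q, hQ⟩ := exists_eq_map_some hn'.1
      have h1 : (l₂ ++ l₁).IsChain G.cone.Adj := by
        have := h.1
        rw [List.cons_append] at this
        exact this.of_cons
      rw [hQ] at h1
      have h2 := hmax Q (isChain_cone_map_some.1 h1) (List.Nodup.of_map _ (hQ ▸ hn'.2))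
      rw [hperm.length_eq, List.length_cons, hQ]
      simpa using h2
    -- A cycle avoiding the apex is in particular a path of `G`, so it is even shorter by one.
    · obtain ⟨Q, rfl⟩ := exists_eq_map_some hnone
      have h2 := hmax Q (isChain_cone_map_some.1 hchain) (List.Nodup.of_map _ hln)
      simp only [List.length_map, List.length_cons]
      omega

/-- If `Z` spares the apex, the apex connects everything; if not, fewer than `k` vertices of `G` are
deleted. -/
theorem cone_separation [Fintype V] {k : ℕ} (hG : G.IsKConnected k) (Z : Finset (Option V))
    (hZ : Z.card < k + 1) (X : Set (Option V)) (hX : ∃ p ∈ X, p ∉ Z)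
    (hcl : ∀ u ∈ X, u ∉ Z → ∀ w ∉ Z, G.cone.Adj u w → w ∈ X) (q : Option V) (hq : q ∉ Z) :
    q ∈ X := by
  classical
  obtain ⟨p, hpX, hpZ⟩ := hX
  by_cases hnone : none ∈ Z
  · have hcard : Z.eraseNone.card < k := by
      rw [Finset.card_eraseNone_of_mem hnone]
      have := Finset.card_pos.2 ⟨_, hnone⟩
      omega
    have hconn := hG.2 _ hcard
    cases p with
    | none => exact absurd hnone hpZ
    | some p =>
    cases q with
    | none => exact absurd hnone hq
    | some q =>
    have hp' : p ∉ Z.eraseNone := by simpa using hpZ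
    have hq' : q ∉ Z.eraseNone := by simpa using hq
    obtain ⟨r⟩ := hconn.preconnected ⟨p, hp'⟩ ⟨q, hq'⟩
    have main : ∀ (a b : {v : V | v ∉ Z.eraseNone}),
        (G.induce {v : V | v ∉ Z.eraseNone}).Walk a b → some a.1 ∈ X → some b.1 ∈ X := by
      intro a b r
      induction r with
      | nil => exact id
      | @cons a b c e _ ih =>
        intro ha
        refine ih (hcl _ ha ?_ _ ?_ (cone_adj_some_some.2 e))
        · have := a.2; simpa using this
        · have := b.2; simpa using this
    exact main _ _ r hpX
  · have h0 : none ∈ X := by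
      by_cases hp : p = none
      · exact hp ▸ hpX
      · exact hcl p hpX hpZ none hnone (cone_adj_none hp).symm
    by_cases hq' : q = none
    · exact hq' ▸ h0
    · exact hcl none h0 hnone q hq (cone_adj_none hq')

theorem cone_card_le_of_indep [Fintype V] {K : ℕ} (hG : G.indepNum ≤ K + 1)
    (s : Finset (Option V)) (hs : ∀ u ∈ s, ∀ v ∈ s, ¬ G.cone.Adj u v) : s.card ≤ K + 1 := by
  classical
  by_cases hnone : none ∈ s
  · have : s ⊆ {none} := by
      intro w hw
      rw [Finset.mem_singleton]
      by_contra hne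
      exact hs _ hnone _ hw (cone_adj_none hne)
    have := Finset.card_le_card this
    rw [Finset.card_singleton] at this
    omega
  · rw [← Finset.card_eraseNone_of_not_mem hnone]
    refine le_trans (IsIndepSet.card_le_indepNum (G := G) ?_) hG
    intro u hu v hv _ e
    have hu' : some u ∈ s := by simpa using hu
    have hv' : some v ∈ s := by simpa using hv
    exact hs _ hu' _ hv' (cone_adj_some_some.2 e)

end Cone

/-! ### Components off the cycle -/

section Component

variable {W : Type*} {G : SimpleGraph W}

/-- The component of `v` in the complement of `C`. -/
theorem exists_component [Fintype W] (C : List W) {v : W} (hv : v ∉ C) :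
    ∃ H : Finset W, v ∈ H ∧ (∀ p ∈ H, p ∉ C) ∧ (∀ p ∈ H, ∀ w ∉ H, G.Adj p w → w ∈ C) ∧
      ∀ p ∈ H, ∀ q ∈ H, ∃ hl, G.Traces p hl q ∧ hl.Nodup ∧ ∀ z ∈ hl, z ∈ H := by
  classical
  refine ⟨Finset.univ.filter fun w => ∃ p : G.Walk v w, ∀ z ∈ p.support, z ∉ C, ?_, ?_, ?_, ?_⟩
  · rw [Finset.mem_filter]
    exact ⟨Finset.mem_univ _, Walk.nil, by simpa using hv⟩
  · intro p hp
    obtain ⟨r, hr⟩ := (Finset.mem_filter.1 hp).2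
    exact hr p r.end_mem_support
  · intro p hp w hw e
    by_contra hwC
    obtain ⟨r, hr⟩ := (Finset.mem_filter.1 hp).2
    refine hw (Finset.mem_filter.2 ⟨Finset.mem_univ _, r.concat e, ?_⟩)
    intro z hz
    rw [Walk.support_concat, List.mem_append, List.mem_singleton] at hz
    rcases hz with hz | rfl
    · exact hr z hz
    · exact hwC
  · intro p hp q hq
    obtain ⟨r, hr⟩ := (Finset.mem_filter.1 hp).2
    obtain ⟨s, hs⟩ := (Finset.mem_filter.1 hq).2
    set t := r.reverse.append s with ht
    refine ⟨t.bypass.support, ⟨t.bypass.isChain_adj_support, ?_, ?_⟩,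
      t.bypass_isPath.support_nodup, ?_⟩
    · rw [List.head?_eq_some_head t.bypass.support_ne_nil, Walk.head_support]
    · rw [List.getLast?_eq_some_getLast t.bypass.support_ne_nil, Walk.getLast_support]
    · intro z hz
      have hz := t.support_bypass_subset_support hz
      rw [ht, Walk.mem_support_append_iff, Walk.support_reverse, List.mem_reverse] at hz
      refine Finset.mem_filter.2 ⟨Finset.mem_univ _, ?_⟩
      rcases hz with hz | hz
      · exact ⟨r.takeUntil z hz, fun y hy => hr y (r.support_takeUntil_subset_support hz hy)⟩
      · exact ⟨s.takeUntil z hz, fun y hy => hs y (s.support_takeUntil_subset_support hz hy)⟩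

end Component

/-! ### From a missed vertex of maximum degree to the saturated situation -/

section MaxDegree

variable {V : Type*} [Fintype V] {G : SimpleGraph V}

/-- A maximum independent set is dominating, so its closed neighbourhoods cover the graph. -/
theorem card_le_indepNum_mul [DecidableRel G.Adj] :
    Fintype.card V ≤ G.indepNum * (G.maxDegree + 1) := by
  classical
  obtain ⟨s, hs⟩ := G.exists_isNIndepSet_indepNum
  have hcov : (Finset.univ : Finset V) ⊆ s.biUnion fun i => insert i (G.neighborFinset i) := by
    intro w _
    rw [Finset.mem_biUnion]
    by_contra! hw
    have hws : w ∉ s := fun h => hw w h (Finset.mem_insert_self _ _)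
    have hind : G.IsIndepSet (insert w s : Finset V) := by
      intro a ha b hb hab e
      rw [Finset.mem_coe, Finset.mem_insert] at ha hb
      rcases ha with rfl | ha <;> rcases hb with rfl | hb
      · exact hab rfl
      · exact hw b hb (Finset.mem_insert_of_mem ((G.mem_neighborFinset _ _).2 e.symm))
      · exact hw a ha (Finset.mem_insert_of_mem ((G.mem_neighborFinset _ _).2 e))
      · exact hs.1 ha hb hab e
    have := hind.card_le_indepNum
    rw [Finset.card_insert_of_notMem hws, hs.2] at this
    omega
  rw [← Finset.card_univ, ← hs.2]
  refine (Finset.card_le_card hcov).trans (Finset.card_biUnion_le_card_mul _ _ _ ?_)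
  intro i _
  refine (Finset.card_insert_le _ _).trans ?_
  rw [card_neighborFinset_eq_degree]
  exact Nat.succ_le_succ (G.degree_le_maxDegree i)

/-- In a large `k`-connected graph with `α ≤ k + 2`, all vertices of maximum degree are Gallai
vertices. -/
theorem isGallaiVertex_of_degree_eq_maxDegree [DecidableRel G.Adj] {k : ℕ} (hk : 1 ≤ k)
    (hn : k * (k + 2) * (2 * k + 3) + 1 ≤ Fintype.card V) (hG : G.IsKConnected k)
    (hα : G.indepNum ≤ k + 2) {v : V} (hv : G.degree v = G.maxDegree) : G.IsGallaiVertex v := by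
  classical
  intro a b r hr
  refine ⟨v, rfl, ?_⟩
  by_contra hvr
  have hC : G.cone.IsLongestCycle (none :: r.support.map some) := by
    refine isLongestCycle_cone r.support_ne_nil r.isChain_adj_support hr.1.support_nodup ?_
    intro Q hQ hQn
    by_cases hne : Q = []
    · simp [hne]
    have := hr.2 _ _ (Walk.ofSupport Q hne hQ) (by
      rw [Walk.isPath_def, Walk.support_ofSupport]; exact hQn)
    rw [Walk.length_ofSupport] at this
    rw [Walk.length_support]
    omega
  set C := none :: r.support.map some with hCdef
  have hvC : some v ∉ C := by simpa [hCdef] using hvr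
  obtain ⟨H, hvH, hoff, hnbr, hconn⟩ := exists_component (G := G.cone) C hvC
  obtain ⟨pre, as, S, hflat, hpre, has, hS⟩ :=
    exists_segments {a | a ∈ C ∧ ∃ p ∈ H, G.cone.Adj a p} C hC.nodup
  -- The cycle is listed from the apex, which is itself a cut as a neighbour of `some v`.
  have hpre' : pre = [] := by
    cases pre with
    | nil => rfl
    | cons x pre =>
      rw [List.cons_append, hCdef] at hflat
      have hx := (List.cons.inj hflat).1
      exact absurd ⟨by rw [← hx]; exact List.mem_cons_self, some v, hvH, by simp [← hx]⟩
        (hpre x List.mem_cons_self)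
  rw [hpre', List.nil_append] at hflat
  have hmem : ∀ w ∈ C, (∃ p ∈ H, G.cone.Adj w p) → w ∈ as := by
    intro w hw hp
    have hw' := hw
    rw [hflat, List.mem_flatMap] at hw'
    obtain ⟨a, ha, hwa⟩ := hw'
    rcases List.mem_cons.1 hwa with rfl | hwa
    · exact ha
    · exact absurd ⟨hw, hp⟩ (hS a ha w hwa)
  have hatt : G.cone.IsAttached C as S H (k + 1) :=
    { toIsLongestCycle := hC
      eq := hflat
      two_le := by omega
      two_le_length := by simp [hCdef]
      nonempty := ⟨_, hvH⟩
      conn := hconn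
      off := hoff
      att := fun a ha => (has a ha).2
      nbr := fun p hp w hw e => hmem w (hnbr p hp w hw e) ⟨p, hp, e.symm⟩
      sep := cone_separation hG
      indep := cone_card_le_of_indep hα }
  have hnone : none ∈ as := hmem none List.mem_cons_self ⟨_, hvH, by simp⟩
  have hHpos : 0 < H.card := Finset.card_pos.2 ⟨_, hvH⟩
  -- The choice of `v` enters here: its neighbours lie in `H` without `v` and among the `k` cuts
  -- other than the apex.
  have hdeg : G.maxDegree + 1 ≤ H.card + k := by
    have hsub : (G.neighborFinset v).image some ⊆
        H.erase (some v) ∪ as.toFinset.erase none := by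
      intro w hw
      obtain ⟨u, hu, rfl⟩ := Finset.mem_image.1 hw
      rw [mem_neighborFinset] at hu
      rw [Finset.mem_union, Finset.mem_erase, Finset.mem_erase, List.mem_toFinset]
      by_cases huH : some u ∈ H
      · exact .inl ⟨fun h => hu.ne (Option.some_injective _ h).symm, huH⟩
      · exact .inr ⟨by simp, hatt.nbr _ hvH _ huH (cone_adj_some_some.2 hu)⟩
    have := (Finset.card_le_card hsub).trans (Finset.card_union_le _ _)
    rw [Finset.card_image_of_injective _ (Option.some_injective V), card_neighborFinset_eq_degree,
      hv, Finset.card_erase_of_mem hvH, Finset.card_erase_of_mem (List.mem_toFinset.2 hnone),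
      hatt.card_toFinset] at this
    omega
  have hcard : Fintype.card V ≤ (k + 2) * (H.card + k) :=
    card_le_indepNum_mul.trans (Nat.mul_le_mul hα hdeg)
  have hsat : G.cone.IsSaturated C as S H (k + 1) none :=
    { toIsAttached := hatt
      mem_as := hnone
      adj_univ := fun w hw => cone_adj_none hw
      -- The bound on the order gives `H.card + k > k * (2 * k + 3)`, that is, `H.card > 2 * k * (k
      -- + 1)`.
      large := by
        have h1 : (k + 2) * (k * (2 * k + 3)) < (k + 2) * (H.card + k) := by
          refine lt_of_lt_of_le ?_ hcard
          refine lt_of_lt_of_le ?_ hn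
          rw [Nat.lt_succ_iff]
          exact le_of_eq (by ring)
        have h2 := Nat.lt_of_mul_lt_mul_left h1
        rw [Nat.add_sub_cancel]
        nlinarith
      total := by
        have h1 : (C.toFinset ∪ H).card ≤ Fintype.card (Option V) := Finset.card_le_univ _
        rw [Finset.card_union_of_disjoint, List.toFinset_card_of_nodup hC.nodup,
          Fintype.card_option] at h1
        · have e : H.card + (k + 1) - 1 = H.card + k := by omega
          rw [e]
          change _ ≤ (k + 2) * _ + 1
          omega
        · rw [Finset.disjoint_left]
          intro w hw hwH
          exact hoff w hwH (List.mem_toFinset.1 hw)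
      deg := by
        intro w hw s hs
        cases w with
        | none => exact absurd rfl hw
        | some u =>
          have hsub : s ⊆ insert none ((G.neighborFinset u).image some) := by
            intro x hx
            cases x with
            | none => exact Finset.mem_insert_self _ _
            | some x =>
              refine Finset.mem_insert_of_mem (Finset.mem_image_of_mem _ ?_)
              rw [mem_neighborFinset]
              exact cone_adj_some_some.1 (hs _ hx)
          have h1 := (Finset.card_le_card hsub).trans (Finset.card_insert_le _ _)
          rw [Finset.card_image_of_injective _ (Option.some_injective V),
            card_neighborFinset_eq_degree] at h1
          have := G.degree_le_maxDegree u
          omega }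
  exact hsat.false

end MaxDegree

/-! ### The example showing that `k + 2` is best possible -/

section JoinedCliques

/-- There are `k + 2` cliques of size `t` and one further clique of size `k`, whose `j`-th vertex
is adjacent to the `j`-th vertex of each of the other cliques. -/
def joinedCliques (k t : ℕ) : SimpleGraph ((Fin (k + 2) × Fin t) ⊕ Fin k) where
  Adj
    | .inl p, .inl q => p.1 = q.1 ∧ p.2 ≠ q.2
    | .inl p, .inr j => p.2.val = j.val
    | .inr j, .inl p => p.2.val = j.val
    | .inr i, .inr j => i ≠ j
  symm := ⟨by
    rintro (p | i) (q | j) h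
    · exact ⟨h.1.symm, h.2.symm⟩
    · exact h
    · exact h
    · exact Ne.symm h⟩
  loopless := ⟨by
    rintro (p | i) h
    · exact h.2 rfl
    · exact h rfl⟩

variable {k t : ℕ}

@[simp] theorem joinedCliques_adj_inl_inl {p q : Fin (k + 2) × Fin t} :
    (joinedCliques k t).Adj (.inl p) (.inl q) ↔ p.1 = q.1 ∧ p.2 ≠ q.2 := Iff.rfl

@[simp] theorem joinedCliques_adj_inl_inr {p : Fin (k + 2) × Fin t} {j : Fin k} :
    (joinedCliques k t).Adj (.inl p) (.inr j) ↔ p.2.val = j.val := Iff.rfl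

@[simp] theorem joinedCliques_adj_inr_inl {p : Fin (k + 2) × Fin t} {j : Fin k} :
    (joinedCliques k t).Adj (.inr j) (.inl p) ↔ p.2.val = j.val := Iff.rfl

@[simp] theorem joinedCliques_adj_inr_inr {i j : Fin k} :
    (joinedCliques k t).Adj (.inr i) (.inr j) ↔ i ≠ j := Iff.rfl

/-- Some index `j < k` is met by no deleted vertex. The `j`-th central vertex and its neighbours in
all large cliques survive, and each remaining vertex is adjacent to one of these. -/
theorem isKConnected_joinedCliques (ht : k ≤ t) : (joinedCliques k t).IsKConnected k := by
  classical
  refine ⟨by simp, ?_⟩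
  intro Z hZ
  obtain ⟨j, hj⟩ : ∃ j : Fin k, ∀ z ∈ Z, z.elim (fun p => p.2.val) (fun i => i.val) ≠ j.val := by
    by_contra! hall
    have hsub : (Finset.range k) ⊆ Z.image fun z => z.elim (fun p => p.2.val) (fun i => i.val) := by
      intro j hj
      obtain ⟨z, hz, h⟩ := hall ⟨j, Finset.mem_range.1 hj⟩
      exact Finset.mem_image.2 ⟨z, hz, h⟩
    have := (Finset.card_le_card hsub).trans Finset.card_image_le
    rw [Finset.card_range] at this
    omega
  have hjZ : Sum.inr j ∉ Z := fun h => hj _ h rfl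
  have hiZ : ∀ i, Sum.inl (i, (⟨j, j.2.trans_le ht⟩ : Fin t)) ∉ Z := fun i h => hj _ h rfl
  have hreach : ∀ w : {v | v ∉ Z},
      ((joinedCliques k t).induce {v | v ∉ Z}).Reachable ⟨.inr j, hjZ⟩ w := by
    rintro ⟨⟨i, s⟩ | i, hw⟩
    · have h1 : ((joinedCliques k t).induce {v | v ∉ Z}).Adj ⟨.inr j, hjZ⟩
          ⟨.inl (i, ⟨j, j.2.trans_le ht⟩), hiZ i⟩ := by simp
      by_cases hs : s = ⟨j, j.2.trans_le ht⟩
      · subst hs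
        exact h1.reachable
      · refine h1.reachable.trans (Adj.reachable ?_)
        simpa using Ne.symm hs
    · by_cases hij : i = j
      · subst hij
        exact Reachable.refl _
      · refine Adj.reachable ?_
        simpa using Ne.symm hij
  have : Nonempty {v : (Fin (k + 2) × Fin t) ⊕ Fin k | v ∉ Z} := ⟨⟨.inr j, hjZ⟩⟩
  exact ⟨fun u w => (hreach u).symm.trans (hreach w)⟩

theorem vertexConnectivity_joinedCliques (ht : k ≤ t) (ht₀ : 0 < t) :
    (joinedCliques k t).vertexConnectivity = k := by
  classical
  have hmax := (joinedCliques k t).isGreatest_vertexConnectivity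
  refine le_antisymm ?_ (hmax.2 (isKConnected_joinedCliques ht))
  by_contra! hlt
  have hconn := hmax.1.2 (Finset.univ.image Sum.inr) (by
    rwa [Finset.card_image_of_injective _ Sum.inr_injective, Finset.card_univ, Fintype.card_fin])
  set Z : Finset ((Fin (k + 2) × Fin t) ⊕ Fin k) := Finset.univ.image Sum.inr with hZ
  have hmem : ∀ p, Sum.inl p ∉ Z := by simp [hZ]
  obtain ⟨r⟩ := hconn.preconnected ⟨.inl (0, ⟨0, ht₀⟩), hmem _⟩ ⟨.inl (1, ⟨0, ht₀⟩), hmem _⟩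
  have main : ∀ a b : {v | v ∉ Z}, ((joinedCliques k t).induce {v | v ∉ Z}).Walk a b →
      a.1.elim (fun p => p.1) (fun _ => 0) = b.1.elim (fun p => p.1) (fun _ => 0) := by
    -- Without the central clique, a walk never changes its large clique.
    intro a b r
    induction r with
    | nil => rfl
    | @cons a b c e _ ih =>
      rw [← ih]
      obtain ⟨p | i, ha⟩ := a
      · obtain ⟨q | j, hb⟩ := b
        · exact e.1
        · exact absurd hb (by simp [hZ])
      · exact absurd ha (by simp [hZ])
  have := main _ _ r
  simp at this

theorem indepNum_joinedCliques (hk : 1 ≤ k) (ht : k < t) :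
    (joinedCliques k t).indepNum = k + 3 := by
  classical
  apply le_antisymm
  · obtain ⟨s, hs⟩ := (joinedCliques k t).exists_isNIndepSet_indepNum
    rw [← hs.2]
    have hinj : Set.InjOn (fun z : (Fin (k + 2) × Fin t) ⊕ Fin k =>
        z.elim (fun p => some p.1) (fun _ => none)) s := by
      intro a ha b hb hab
      by_contra hne
      apply hs.1 ha hb hne
      rcases a with ⟨i, u⟩ | i <;> rcases b with ⟨j, w⟩ | j
      · simp only [Sum.elim_inl, Option.some.injEq] at hab
        subst hab
        refine ⟨rfl, ?_⟩
        rintro rfl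
        exact hne rfl
      · simp at hab
      · simp at hab
      · rw [joinedCliques_adj_inr_inr]
        rintro rfl
        exact hne rfl
    rw [← Finset.card_image_of_injOn hinj]
    refine (Finset.card_le_univ _).trans ?_
    simp
  -- The vertices of index `k` have no central neighbour, so one from each large clique can be
  -- joined by a central vertex.
  · have hinj : Function.Injective (fun z : Option (Fin (k + 2)) =>
        (z.elim (.inr ⟨0, hk⟩) fun i => .inl (i, ⟨k, ht⟩) : (Fin (k + 2) × Fin t) ⊕ Fin k)) := by
      rintro (_ | i) (_ | j) h <;> simp_all
    have hind : (joinedCliques k t).IsIndepSet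
        (Finset.univ.image (fun z : Option (Fin (k + 2)) =>
        (z.elim (.inr ⟨0, hk⟩) fun i => .inl (i, ⟨k, ht⟩) : (Fin (k + 2) × Fin t) ⊕ Fin k)) :
          Finset _) := by
      intro a ha b hb _
      obtain ⟨z, -, rfl⟩ := Finset.mem_image.1 (Finset.mem_coe.1 ha)
      obtain ⟨w, -, rfl⟩ := Finset.mem_image.1 (Finset.mem_coe.1 hb)
      have hk' : k ≠ 0 := by omega
      rcases z with _ | i <;> rcases w with _ | j <;> simp [hk']
    have := hind.card_le_indepNum
    rwa [Finset.card_image_of_injective _ hinj, Finset.card_univ, Fintype.card_option,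
      Fintype.card_fin] at this

theorem degree_inr_le [DecidableRel (joinedCliques k t).Adj] (ht : k ≤ t) (j : Fin k) :
    (joinedCliques k t).degree (.inr j) ≤ 2 * k + 2 := by
  classical
  have hsub : (joinedCliques k t).neighborFinset (.inr j) ⊆
      Finset.univ.image (fun i => Sum.inl (i, ⟨j, j.2.trans_le ht⟩)) ∪
        Finset.univ.image Sum.inr := by
    rintro (⟨i, s⟩ | i) h
    · rw [mem_neighborFinset, joinedCliques_adj_inr_inl] at h
      refine Finset.mem_union_left _ (Finset.mem_image.2 ⟨i, Finset.mem_univ _, ?_⟩)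
      simp [← h]
    · exact Finset.mem_union_right _ (Finset.mem_image_of_mem _ (Finset.mem_univ _))
  rw [← card_neighborFinset_eq_degree]
  refine (Finset.card_le_card hsub).trans ((Finset.card_union_le _ _).trans ?_)
  have h1 := Finset.card_image_le (s := Finset.univ)
    (f := fun i : Fin (k + 2) => (Sum.inl (i, ⟨j, j.2.trans_le ht⟩) :
      (Fin (k + 2) × Fin t) ⊕ Fin k))
  have h2 := Finset.card_image_le (s := Finset.univ)
    (f := (Sum.inr : Fin k → (Fin (k + 2) × Fin t) ⊕ Fin k))
  rw [Finset.card_univ, Fintype.card_fin] at h1 h2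
  omega

theorem le_degree_inl [DecidableRel (joinedCliques k t).Adj] (p : Fin (k + 2) × Fin t) :
    t - 1 ≤ (joinedCliques k t).degree (.inl p) := by
  classical
  have hsub : (Finset.univ.erase p.2).image (fun s => Sum.inl (p.1, s)) ⊆
      (joinedCliques k t).neighborFinset (.inl p) := by
    intro z hz
    obtain ⟨s, hs, rfl⟩ := Finset.mem_image.1 hz
    rw [mem_neighborFinset]
    exact ⟨rfl, (Finset.ne_of_mem_erase hs).symm⟩
  have := Finset.card_le_card hsub
  rwa [Finset.card_image_of_injective _ (fun a b h => by simpa using h),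
    Finset.card_erase_of_mem (Finset.mem_univ _), Finset.card_univ, Fintype.card_fin,
    card_neighborFinset_eq_degree] at this

/-- A walk visits at most one clique more than it has vertices in the separating clique. -/
theorem card_cliques_le_of_isChain (l : List ((Fin (k + 2) × Fin t) ⊕ Fin k))
    (hl : l.IsChain (joinedCliques k t).Adj) :
    (l.filterMap fun z => z.elim (fun p => some p.1) fun _ => none).toFinset.card ≤
      (l.filterMap fun z => z.elim (fun _ => none) some).length + 1 ∧
    ∀ j, l.head? = some (.inr j) →
      (l.filterMap fun z => z.elim (fun p => some p.1) fun _ => none).toFinset.card ≤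
        (l.filterMap fun z => z.elim (fun _ => none) some).length := by
  -- The sharper bound for walks that start in the centre carries the induction when a walk steps
  -- from a large clique into the centre.
  induction l with
  | nil => simp
  | cons x l ih =>
    obtain ⟨ih₁, ih₂⟩ := ih hl.of_cons
    cases x with
    | inr i =>
      simp only [List.filterMap_cons, Sum.elim_inr, List.length_cons]
      exact ⟨by omega, fun _ _ => ih₁⟩
    | inl p =>
      simp only [List.filterMap_cons, Sum.elim_inl]
      refine ⟨?_, by simp⟩
      rw [List.toFinset_cons]
      cases l with
      | nil => simp
      | cons y l =>
        rw [List.isChain_cons_cons] at hl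
        cases y with
        | inr j =>
          exact (Finset.card_insert_le _ _).trans (Nat.succ_le_succ (ih₂ j rfl))
        | inl q =>
          rw [Finset.insert_eq_of_mem]
          · exact ih₁
          · have h : p.1 = q.1 := hl.1.1
            rw [List.mem_toFinset, List.filterMap_cons]
            simp [h]

/-- A path has at most `k` central vertices, hence vertices of at most `k + 1` large cliques. -/
theorem length_le_of_isChain (l : List ((Fin (k + 2) × Fin t) ⊕ Fin k))
    (hl : l.IsChain (joinedCliques k t).Adj) (hn : l.Nodup) : l.length ≤ (k + 1) * t + k := by
  classical
  have h1 := (card_cliques_le_of_isChain l hl).1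
  set A := (l.filterMap fun z => z.elim (fun p => some p.1) fun _ => none).toFinset with hA
  set B := l.filterMap fun z => z.elim (fun _ => none) some with hB
  have hBn : B.Nodup := by
    refine hn.filterMap ?_
    rintro (p | i) (q | j) b h₁ h₂ <;> simp_all
  have hBk : B.length ≤ k := by
    rw [← List.toFinset_card_of_nodup hBn]
    simpa using Finset.card_le_univ B.toFinset
  have hsub : l.toFinset ⊆ (A ×ˢ Finset.univ).image Sum.inl ∪ Finset.univ.image Sum.inr := by
    rintro (p | i) h
    · rw [List.mem_toFinset] at h
      refine Finset.mem_union_left _ (Finset.mem_image_of_mem _ ?_)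
      rw [Finset.mem_product]
      refine ⟨?_, Finset.mem_univ _⟩
      rw [hA, List.mem_toFinset, List.mem_filterMap]
      exact ⟨_, h, rfl⟩
    · exact Finset.mem_union_right _ (Finset.mem_image_of_mem _ (Finset.mem_univ _))
  have h2 := (Finset.card_le_card hsub).trans (Finset.card_union_le _ _)
  rw [List.toFinset_card_of_nodup hn, Finset.card_image_of_injective _ Sum.inl_injective,
    Finset.card_image_of_injective _ Sum.inr_injective, Finset.card_product, Finset.card_univ,
    Finset.card_univ, Fintype.card_fin, Fintype.card_fin] at h2
  have h3 : A.card * t ≤ (k + 1) * t := Nat.mul_le_mul_right t (by omega)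
  omega

theorem exists_traces_clique (c : Fin (k + 2)) {s s' : Fin t} (hs : s ≠ s') :
    ∃ l, (joinedCliques k t).Traces (.inl (c, s)) l (.inl (c, s')) ∧ l.Nodup ∧ l.length = t ∧
      ∀ z ∈ l, ∃ u, z = .inl (c, u) := by
  classical
  have hn : ((List.finRange t).map fun u =>
      (Sum.inl (c, u) : (Fin (k + 2) × Fin t) ⊕ Fin k)).Nodup :=
    (List.nodup_finRange t).map fun a b h => by simpa using h
  obtain ⟨l, hl, hp⟩ := exists_traces_of_pairwise (G := joinedCliques k t) hn (by
    intro u hu w hw hne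
    obtain ⟨a, -, rfl⟩ := List.mem_map.1 hu
    obtain ⟨b, -, rfl⟩ := List.mem_map.1 hw
    refine ⟨rfl, ?_⟩
    rintro h
    exact hne (by rw [show a = b from h]))
    (p := .inl (c, s)) (q := .inl (c, s')) (by simp) (by simp) (by simpa using hs)
  refine ⟨l, hl, hp.nodup_iff.2 hn, by simpa using hp.length_eq, ?_⟩
  intro z hz
  obtain ⟨u, -, rfl⟩ := List.mem_map.1 (hp.mem_iff.1 hz)
  exact ⟨u, rfl⟩

/-- There is a path through all vertices outside a given clique. -/
theorem exists_traces_avoiding (ht : k < t) (hk : 1 ≤ k) (i : Fin (k + 2)) (j : ℕ)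
    (hj : j < k + 1) :
    ∃ l u, (joinedCliques k t).Traces u l (.inl (i.succAbove ⟨j, hj⟩, ⟨j, by omega⟩)) ∧ l.Nodup ∧
      l.length = (j + 1) * t + j ∧
      ∀ z ∈ l, (∃ (m : ℕ) (hm : m < k + 1) (s : Fin t), m ≤ j ∧
          z = .inl (i.succAbove ⟨m, hm⟩, s)) ∨
        ∃ a : Fin k, a.val < j ∧ z = .inr a := by
  induction j with
  | zero =>
    -- The starting index `1` is arbitrary; it only has to differ from the exit index `0`.
    obtain ⟨l, hl, hn, hlen, hmem⟩ := exists_traces_clique (k := k)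
      (i.succAbove ⟨0, hj⟩) (s := ⟨1, by omega⟩) (s' := (⟨0, by omega⟩ : Fin t)) (by simp)
    refine ⟨l, _, hl, hn, by simp [hlen], ?_⟩
    intro z hz
    obtain ⟨u, rfl⟩ := hmem z hz
    exact .inl ⟨0, hj, u, le_refl _, rfl⟩
  | succ j ih =>
    obtain ⟨l, u, hl, hn, hlen, hmem⟩ := ih (by omega)
    -- The path crosses by the `j`-th central vertex, enters the next clique at index `j` and leaves
    -- it at `j + 1`. The last exit index is `k`, which is why `k < t` is needed.
    obtain ⟨l', hl', hn', hlen', hmem'⟩ := exists_traces_clique (k := k)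
      (i.succAbove ⟨j + 1, hj⟩) (s := ⟨j, by omega⟩) (s' := (⟨j + 1, by omega⟩ : Fin t)) (by simp)
    have e₁ : (joinedCliques k t).Adj (.inl (i.succAbove ⟨j, by omega⟩, ⟨j, by omega⟩))
      (.inr ⟨j, by omega⟩) := by simp
    have e₂ : (joinedCliques k t).Adj (.inr ⟨j, by omega⟩)
      (.inl (i.succAbove ⟨j + 1, hj⟩, ⟨j, by omega⟩)) := by simp
    refine ⟨l ++ ([.inr ⟨j, by omega⟩] ++ l'), u,
      hl.append e₁ ((Traces.single _).append e₂ hl'), ?_, ?_, ?_⟩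
    · rw [List.nodup_append]
      refine ⟨hn, ?_, ?_⟩
      · rw [List.singleton_append, List.nodup_cons]
        refine ⟨?_, hn'⟩
        intro h
        obtain ⟨_, h⟩ := hmem' _ h
        simp at h
      · rintro z hz w hw rfl
        rw [List.singleton_append, List.mem_cons] at hw
        rcases hmem z hz with ⟨m, hm, s, hmj, rfl⟩ | ⟨a, ha, rfl⟩ <;> rcases hw with hw | hw
        · simp at hw
        · obtain ⟨w, h⟩ := hmem' _ hw
          have := (Prod.mk.inj (Sum.inl_injective h)).1
          have := Fin.mk.inj (Fin.succAbove_right_injective this)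
          omega
        · have := congrArg Fin.val (Sum.inr_injective hw)
          simp only at this
          omega
        · obtain ⟨w, h⟩ := hmem' _ hw
          simp at h
    · simp only [List.length_append, hlen, hlen', List.length_singleton]
      ring
    · intro z hz
      rw [List.mem_append, List.singleton_append, List.mem_cons] at hz
      rcases hz with hz | rfl | hz
      · rcases hmem z hz with ⟨m, hm, s, hmj, rfl⟩ | ⟨a, ha, rfl⟩
        · exact .inl ⟨m, hm, s, by omega, rfl⟩
        · exact .inr ⟨a, by omega, rfl⟩
      · exact .inr ⟨_, by simp, rfl⟩
      · obtain ⟨s, rfl⟩ := hmem' z hz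
        exact .inl ⟨_, hj, s, le_refl _, rfl⟩

/-- The path through all other large cliques and all central vertices attains the bound of
`length_le_of_isChain`. -/
theorem not_isGallaiVertex_inl (ht : k < t) (hk : 1 ≤ k) (p : Fin (k + 2) × Fin t) :
    ¬ (joinedCliques k t).IsGallaiVertex (.inl p) := by
  intro h
  obtain ⟨l, u, hl, hn, hlen, hmem⟩ := exists_traces_avoiding ht hk p.1 k (Nat.lt_succ_self k)
  obtain ⟨w, rfl, hw⟩ := h _ _ (Walk.ofSupport l hl.ne_nil hl.1) (by
    refine ⟨by rw [Walk.isPath_def, Walk.support_ofSupport]; exact hn, ?_⟩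
    intro a b q hq
    have := length_le_of_isChain q.support q.isChain_adj_support hq.support_nodup
    rw [Walk.length_support] at this
    rw [Walk.length_ofSupport]
    omega)
  rw [Walk.support_ofSupport] at hw
  rcases hmem _ hw with ⟨m, hm, s, -, hp⟩ | ⟨a, -, hp⟩
  · rw [Sum.inl.injEq] at hp
    exact Fin.succAbove_ne p.1 ⟨m, hm⟩ (congrArg Prod.fst hp).symm
  · simp at hp

theorem not_isGallaiVertex_joinedCliques [DecidableRel (joinedCliques k t).Adj] (hk : 1 ≤ k)
    (ht : 2 * k + 4 ≤ t) (v : (Fin (k + 2) × Fin t) ⊕ Fin k)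
    (hv : (joinedCliques k t).degree v = (joinedCliques k t).maxDegree) :
    ¬ (joinedCliques k t).IsGallaiVertex v := by
  cases v with
  | inl p => exact not_isGallaiVertex_inl (by omega) hk p
  | inr j =>
    -- Central degrees are at most `2 * k + 2`, below the `t - 1 ≥ 2 * k + 3` of a large clique, so
    -- this case is void.
    have h1 := degree_inr_le (t := t) (by omega) j
    have h2 := le_degree_inl (k := k) (t := t) (0, ⟨0, by omega⟩)
    have h3 := (joinedCliques k t).degree_le_maxDegree (.inl (0, ⟨0, by omega⟩))
    omega

end JoinedCliques

end SimpleGraph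

theorem theorem22 (k : ℕ) (hk : 1 ≤ k) :
    (∀ (V : Type*) [Fintype V] (G : SimpleGraph V) [DecidableRel G.Adj],
      k * (k + 2) * (2 * k + 3) + 1 ≤ Fintype.card V →
      G.IsKConnected k →
      G.indepNum ≤ k + 2 →
      ∀ v : V, G.degree v = G.maxDegree → G.IsGallaiVertex v) ∧
    (∀ N : ℕ, ∃ (V : Type) (_ : Fintype V) (G : SimpleGraph V) (_ : DecidableRel G.Adj),
      N ≤ Fintype.card V ∧
      G.IsKConnected k ∧
      G.vertexConnectivity = k ∧
      G.indepNum = k + 3 ∧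
      ∀ v : V, G.degree v = G.maxDegree → ¬ G.IsGallaiVertex v) := by
  classical
  refine ⟨?_, ?_⟩
  · intro V _ G _ hn hG hα v hv
    exact G.isGallaiVertex_of_degree_eq_maxDegree hk hn hG hα hv
  · intro N
    refine ⟨(Fin (k + 2) × Fin (N + 2 * k + 4)) ⊕ Fin k, inferInstance,
      SimpleGraph.joinedCliques k (N + 2 * k + 4), inferInstance, ?_,
      SimpleGraph.isKConnected_joinedCliques (by omega),
      SimpleGraph.vertexConnectivity_joinedCliques (by omega) (by omega),
      SimpleGraph.indepNum_joinedCliques hk (by omega), ?_⟩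
    · rw [Fintype.card_sum, Fintype.card_prod, Fintype.card_fin, Fintype.card_fin,
        Fintype.card_fin]
      nlinarith
    · intro v hv
      exact SimpleGraph.not_isGallaiVertex_joinedCliques hk (by omega) v hv
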